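/- Let $M$ be a compact smooth Riemannian manifold without boundary, with gradient $\nabla$ and volume measure $dx$, and write $\langle f,g\rangle=\int_M fg\,dx$. The space $C^\infty(M)$ carries its Fréchet topology, and smoothness of maps on open subsets of $C^\infty(M)$ is understood in the usual sense (equivalently: smooth finite-dimensional families of functions are sent to smooth families). For a functional $G$ on an open set of $C^\infty(M)$, $\delta G(f)\in C^\infty(M)$ denotes its first variation ($L^2$ gradient), defined by $\frac{d}{d\varepsilon}\big|_{\varepsilon=0}G(f+\varepsilon\varphi)=\langle \delta G(f),\varphi\rangle$ for all $\varphi\in C^\infty(M)$; partial $L^2$ gradients are written $\partial_\rho,\partial_S,\partial_\eta,\partial_{\eta^*}$. The second variation $\delta^2G(f)$ is the operator $\varphi\mapsto \frac{d}{d\varepsilon}\big|_{\varepsilon=0}\delta G(f+\varepsilon\varphi)$ on $C^\infty(M)$. Let $U\subset C^\infty(M)$ be open and let $\mathcal F\colon U\to\mathbb R$ be a smooth functional possessing a smooth first variation $\delta\mathcal F\colon U\to C^\infty(M)$ which is smoothly invertible: $\delta\mathcal F$ is injective on $U$, $\delta\mathcal F(U)$ is open, and $(\delta\mathcal F)^{-1}\colon\delta\mathcal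 F(U)\to U$ is smooth. Put $$\mathcal H(\rho,S)=\tfrac12\int_M|\nabla S|^2\rho\,dx-\tfrac12\int_M|\nabla\delta\mathcal F(\rho)|^2\rho\,dx ,\qquad \rho\in U,\ S\in C^\infty(M).$$ For $\eta,\eta^*\in U$ with $\delta\mathcal F(\eta)+\delta\mathcal F(\eta^*)\in\delta\mathcal F(U)$, the Hopf–Cole transformation is $s(\eta,\eta^*)=(\rho,S)$, where $\rho\in U$ and $$\delta\mathcal F(\rho)=\delta\mathcal F(\eta)+\delta\mathcal F(\eta^*),\qquad S=\delta\mathcal F(\eta)-\delta\mathcal F(\eta^*).$$ Let $\mathcal K=\mathcal H\circ s$ and, with this $\rho$, let $$\sigma(\eta,\eta^*)=-\tfrac12\,[\delta^2\mathcal F(\eta)]^{-1}\,\delta^2\mathcal F(\rho)\,[\delta^2\mathcal F(\eta^*)]^{-1}.$$ Then $\delta^2\mathcal F(f)\colon C^\infty(M)\to C^\infty(M)$ is bijective for every $f\in U$, so that $\sigma$ is well defined on the domain of $s$. Moreover: (1) Let $J\subset\mathbb R$ be open (for instance $J=(0,T)$), and let $(\rho_t,S_t)_{t\in J}$ be a solution,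 smooth on $J\times M$, of the Wasserstein Hamiltonian flow $$\partial_t\rho_t=\partial_S\mathcal H(\rho_t,S_t),\qquad \partial_tS_t=-\partial_\rho\mathcal H(\rho_t,S_t),$$ where each $\rho_t\in U$ is a strictly positive probability density. Suppose $(\rho_t,S_t)=s(\eta_t,\eta^*_t)$ for all $t\in J$, where $(\eta_t,\eta_t^*)$ lies in the domain of $s$. Then $\eta_t,\eta^*_t$ are smooth on $J\times M$, the partial $L^2$ gradients of $\mathcal K$ exist at $(\eta_t,\eta_t^*)$, and for all $t\in J$ $$\partial_t\eta_t=\sigma(\eta_t,\eta^*_t)\,\partial_{\eta^*}\mathcal K(\eta_t,\eta^*_t),\qquad \partial_t\eta^*_t=-\sigma(\eta^*_t,\eta_t)\,\partial_\eta\mathcal K(\eta_t,\eta^*_t).$$ (2) For every $(\eta,\eta^*)$ in the domain of $s$ and all $\alpha,\beta\in C^\infty(M)$, $$\langle\sigma(\eta,\eta^*)\alpha,\beta\rangle=-\tfrac12\langle\delta^2\mathcal F(\rho)\bar\alpha,\bar\beta\rangle,\quad\text{where } \delta^2\mathcal F(\eta^*)\bar\alpha=\alpha,\ \ \delta^2\mathcal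 F(\eta)\bar\beta=\beta ,$$ and $\sigma(\eta^*,\eta)$ is the adjoint of $\sigma(\eta,\eta^*)$: $\langle\sigma(\eta^*,\eta)\alpha,\beta\rangle=\langle\alpha,\sigma(\eta,\eta^*)\beta\rangle$. -/

import Mathlib

open MeasureTheory Bundle Manifold
open scoped ContDiff

noncomputable section

namespace HopfCole

section Calculus

variable {d : ℕ} {M : Type*} [TopologicalSpace M] [ChartedSpace (EuclideanSpace ℝ (Fin d)) M]

/-- A family `v ↦ p v` of smooth functions on `M`, with parameter `v` in a subset `O` of a
normed space, is smooth if `(v, x) ↦ p v x` is smooth on `O × M`. -/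
def SmoothFamily {P : Type*} [NormedAddCommGroup P] [NormedSpace ℝ P] (O : Set P)
    (p : P → C^∞⟮𝓡 d, M; ℝ⟯) : Prop :=
  ContMDiffOn (𝓘(ℝ, P).prod (𝓡 d)) 𝓘(ℝ, ℝ) ∞ (fun q : P × M => p q.1 q.2) (O ×ˢ Set.univ)

/-- `U` is open in `C^∞(M)`: its preimage under every smooth finite-dimensional family is open
(the `c^∞`-topology, which for compact `M` is the Fréchet topology of `C^∞(M)`). -/
def IsOpenSmooth (U : Set C^∞⟮𝓡 d, M; ℝ⟯) : Prop :=
  ∀ (P : Type) [NormedAddCommGroup P] [NormedSpace ℝ P] [FiniteDimensional ℝ P]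
    (O : Set P) (p : P → C^∞⟮𝓡 d, M; ℝ⟯), IsOpen O → SmoothFamily O p →
      IsOpen {v | v ∈ O ∧ p v ∈ U}

/-- `F` is a smooth functional on `U`: it sends smooth finite-dimensional families in `U` to
smooth functions of the parameter. -/
def SmoothFunctionalOn (U : Set C^∞⟮𝓡 d, M; ℝ⟯) (F : C^∞⟮𝓡 d, M; ℝ⟯ → ℝ) : Prop :=
  ∀ (P : Type) [NormedAddCommGroup P] [NormedSpace ℝ P] [FiniteDimensional ℝ P]
    (O : Set P) (p : P → C^∞⟮𝓡 d, M; ℝ⟯), IsOpen O → SmoothFamily O p → (∀ v ∈ O, p v ∈ U) →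
      ContDiffOn ℝ ∞ (fun v => F (p v)) O

/-- `Φ` is a smooth map from `U` to `C^∞(M)`: it sends smooth finite-dimensional families in `U`
to smooth families. -/
def SmoothMapOn (U : Set C^∞⟮𝓡 d, M; ℝ⟯) (Φ : C^∞⟮𝓡 d, M; ℝ⟯ → C^∞⟮𝓡 d, M; ℝ⟯) : Prop :=
  ∀ (P : Type) [NormedAddCommGroup P] [NormedSpace ℝ P] [FiniteDimensional ℝ P]
    (O : Set P) (p : P → C^∞⟮𝓡 d, M; ℝ⟯), IsOpen O → SmoothFamily O p → (∀ v ∈ O, p v ∈ U) →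
      SmoothFamily O (fun v => Φ (p v))

/-- `g` is the derivative at `t` of the path `τ ↦ f τ` of smooth functions. -/
def HasPathDeriv (f : ℝ → C^∞⟮𝓡 d, M; ℝ⟯) (g : C^∞⟮𝓡 d, M; ℝ⟯) (t : ℝ) : Prop :=
  ∀ x : M, HasDerivAt (fun τ => f τ x) (g x) t

open Classical in
/-- The derivative of `Φ` at `f` in the direction `φ` (and `0` if it does not exist). -/
def dirDeriv (Φ : C^∞⟮𝓡 d, M; ℝ⟯ → C^∞⟮𝓡 d, M; ℝ⟯) (f φ : C^∞⟮𝓡 d, M; ℝ⟯) :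
    C^∞⟮𝓡 d, M; ℝ⟯ :=
  if h : ∃ g, HasPathDeriv (fun ε : ℝ => Φ (f + ε • φ)) g 0 then h.choose else 0

end Calculus

section Geometry

variable {d : ℕ} {M : Type*} [EMetricSpace M] [MeasurableSpace M] [BorelSpace M]
  [ChartedSpace (EuclideanSpace ℝ (Fin d)) M]

/-- The Riemannian volume measure of a `d`-dimensional Riemannian manifold: the `d`-dimensional
Hausdorff measure of the Riemannian distance, normalized so as to agree with Lebesgue measure on
Euclidean space. -/
def vol (d : ℕ) (M : Type*) [EMetricSpace M] [MeasurableSpace M] [BorelSpace M] : Measure M :=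
  μHE[d]

/-- The set `P₊(M)` of smooth, strictly positive probability densities. -/
def densityManifold (d : ℕ) (M : Type*) [EMetricSpace M] [MeasurableSpace M] [BorelSpace M]
    [ChartedSpace (EuclideanSpace ℝ (Fin d)) M] : Set C^∞⟮𝓡 d, M; ℝ⟯ :=
  {ρ | (∀ x, 0 < ρ x) ∧ ∫ x, ρ x ∂(vol d M) = 1}

/-- The `L²` pairing of two smooth functions. -/
def pairing (f g : C^∞⟮𝓡 d, M; ℝ⟯) : ℝ := ∫ x, f x * g x ∂(vol d M)

/-- `g` is the first variation (`L²` gradient) of the functional `F` at `f`. -/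
def HasFirstVariation (F : C^∞⟮𝓡 d, M; ℝ⟯ → ℝ) (f g : C^∞⟮𝓡 d, M; ℝ⟯) : Prop :=
  ∀ φ : C^∞⟮𝓡 d, M; ℝ⟯, HasDerivAt (fun ε : ℝ => F (f + ε • φ)) (pairing g φ) 0

open Classical in
/-- The first variation `δF(f)` (and `0` if it does not exist). -/
def firstVariation (F : C^∞⟮𝓡 d, M; ℝ⟯ → ℝ) (f : C^∞⟮𝓡 d, M; ℝ⟯) : C^∞⟮𝓡 d, M; ℝ⟯ :=
  if h : ∃ g, HasFirstVariation F f g then h.choose else 0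

/-- The second variation (`L²` Hessian) `δ²F(f)`, as an operator on `C^∞(M)`: the derivative
of `δF` at `f`. -/
def secondVariation (F : C^∞⟮𝓡 d, M; ℝ⟯ → ℝ) (f : C^∞⟮𝓡 d, M; ℝ⟯) :
    C^∞⟮𝓡 d, M; ℝ⟯ → C^∞⟮𝓡 d, M; ℝ⟯ :=
  dirDeriv (firstVariation F) f

/-- The inverse operator `[δ²F(f)]⁻¹`. -/
def secondVariationInv (F : C^∞⟮𝓡 d, M; ℝ⟯ → ℝ) (f : C^∞⟮𝓡 d, M; ℝ⟯) :
    C^∞⟮𝓡 d, M; ℝ⟯ → C^∞⟮𝓡 d, M; ℝ⟯ :=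
  Function.invFun (secondVariation F f)

/-- `F` is a smooth potential on the open set `U ⊆ C^∞(M)`, with a smooth first variation
`δF : U → C^∞(M)`. -/
structure IsSmoothPotential (U : Set C^∞⟮𝓡 d, M; ℝ⟯) (F : C^∞⟮𝓡 d, M; ℝ⟯ → ℝ) : Prop where
  isOpen : IsOpenSmooth U
  smooth : SmoothFunctionalOn U F
  hasFirstVariation : ∀ f ∈ U, ∃ g, HasFirstVariation F f g
  smooth_firstVariation : SmoothMapOn U (firstVariation F)

/-- The inverse `(δF)⁻¹ : δF(U) → U` of the first variation. -/
def firstVariationInv (U : Set C^∞⟮𝓡 d, M; ℝ⟯) (F : C^∞⟮𝓡 d, M; ℝ⟯ → ℝ) :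
    C^∞⟮𝓡 d, M; ℝ⟯ → C^∞⟮𝓡 d, M; ℝ⟯ :=
  Function.invFunOn (firstVariation F) U

/-- `δF` is smoothly invertible on `U`: it is injective on `U`, with open image and smooth
inverse. -/
structure IsInvertibleFirstVariation (U : Set C^∞⟮𝓡 d, M; ℝ⟯) (F : C^∞⟮𝓡 d, M; ℝ⟯ → ℝ) :
    Prop where
  injOn : Set.InjOn (firstVariation F) U
  isOpen_image : IsOpenSmooth (firstVariation F '' U)
  smooth_inv : SmoothMapOn (firstVariation F '' U) (firstVariationInv U F)

/-- The domain of the Hopf--Cole transformation: pairs `(η, η*)` in `U` for which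
`δF(ρ) = δF(η) + δF(η*)` has a solution `ρ` in `U`. -/
def hopfColeDomain (U : Set C^∞⟮𝓡 d, M; ℝ⟯) (F : C^∞⟮𝓡 d, M; ℝ⟯ → ℝ) :
    Set (C^∞⟮𝓡 d, M; ℝ⟯ × C^∞⟮𝓡 d, M; ℝ⟯) :=
  {q | q.1 ∈ U ∧ q.2 ∈ U ∧ firstVariation F q.1 + firstVariation F q.2 ∈ firstVariation F '' U}

/-- The Hopf--Cole transformation `s(η, η*) = (ρ, S)`, where `δF(ρ) = δF(η) + δF(η*)` and
`S = δF(η) - δF(η*)`. -/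
def hopfCole (U : Set C^∞⟮𝓡 d, M; ℝ⟯) (F : C^∞⟮𝓡 d, M; ℝ⟯ → ℝ)
    (q : C^∞⟮𝓡 d, M; ℝ⟯ × C^∞⟮𝓡 d, M; ℝ⟯) : C^∞⟮𝓡 d, M; ℝ⟯ × C^∞⟮𝓡 d, M; ℝ⟯ :=
  (firstVariationInv U F (firstVariation F q.1 + firstVariation F q.2),
    firstVariation F q.1 - firstVariation F q.2)

/-- The operator
`σ(η, η*) = -½ [δ²F(η)]⁻¹ δ²F(ρ) [δ²F(η*)]⁻¹`, where `ρ = (δF)⁻¹(δF(η) + δF(η*))`. -/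
def sigma (U : Set C^∞⟮𝓡 d, M; ℝ⟯) (F : C^∞⟮𝓡 d, M; ℝ⟯ → ℝ) (η ηs α : C^∞⟮𝓡 d, M; ℝ⟯) :
    C^∞⟮𝓡 d, M; ℝ⟯ :=
  (-(1 / 2) : ℝ) • secondVariationInv F η
    (secondVariation F (hopfCole U F (η, ηs)).1 (secondVariationInv F ηs α))

variable [RiemannianBundle (fun x : M => TangentSpace (𝓡 d) x)]

instance instCompleteSpaceTangentSpace (d : ℕ) (M : Type*) [EMetricSpace M]
    [ChartedSpace (EuclideanSpace ℝ (Fin d)) M]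
    [RiemannianBundle (fun x : M => TangentSpace (𝓡 d) x)] (x : M) :
    CompleteSpace (TangentSpace (𝓡 d) x) :=
  haveI : FiniteDimensional ℝ (TangentSpace (𝓡 d) x) :=
    inferInstanceAs (FiniteDimensional ℝ (EuclideanSpace ℝ (Fin d)))
  FiniteDimensional.complete ℝ _

/-- The Riemannian gradient `∇f(x) ∈ T_x M`: the Riesz representative of the differential of `f`
at `x` for the Riemannian inner product on `T_x M`. -/
def grad (f : C^∞⟮𝓡 d, M; ℝ⟯) (x : M) : TangentSpace (𝓡 d) x :=
  (InnerProductSpace.toDual ℝ (TangentSpace (𝓡 d) x)).symm (mvfderiv (𝓡 d) f x)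

/-- The Hamiltonian `H(ρ, S) = ½ ∫ |∇S|² ρ dx - ½ ∫ |∇δF(ρ)|² ρ dx`. -/
def hamiltonian (F : C^∞⟮𝓡 d, M; ℝ⟯ → ℝ) (ρ S : C^∞⟮𝓡 d, M; ℝ⟯) : ℝ :=
  1 / 2 * ∫ x, ‖grad S x‖ ^ 2 * ρ x ∂(vol d M) -
    1 / 2 * ∫ x, ‖grad (firstVariation F ρ) x‖ ^ 2 * ρ x ∂(vol d M)

/-- The Hamiltonian `K = H ∘ s` in the Hopf--Cole variables. -/
def hopfColeHamiltonian (U : Set C^∞⟮𝓡 d, M; ℝ⟯) (F : C^∞⟮𝓡 d, M; ℝ⟯ → ℝ)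
    (η ηs : C^∞⟮𝓡 d, M; ℝ⟯) : ℝ :=
  hamiltonian F (hopfCole U F (η, ηs)).1 (hopfCole U F (η, ηs)).2

/-- `(ρ_t, S_t)`, `t ∈ J`, is a smooth solution with `ρ_t ∈ U ∩ P₊(M)` of the Wasserstein
Hamiltonian flow `∂_t ρ_t = ∂_S H(ρ_t, S_t)`, `∂_t S_t = -∂_ρ H(ρ_t, S_t)`, where `∂_S` and `∂_ρ`
are partial `L²` gradients. -/
structure IsHamiltonianFlow (J : Set ℝ) (U : Set C^∞⟮𝓡 d, M; ℝ⟯) (F : C^∞⟮𝓡 d, M; ℝ⟯ → ℝ)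
    (ρ S : ℝ → C^∞⟮𝓡 d, M; ℝ⟯) : Prop where
  smooth_density : SmoothFamily J ρ
  smooth_momentum : SmoothFamily J S
  mem_domain : ∀ t ∈ J, ρ t ∈ U
  mem_density : ∀ t ∈ J, ρ t ∈ densityManifold d M
  density_eq : ∀ t ∈ J, ∃ g, HasFirstVariation (fun T => hamiltonian F (ρ t) T) (S t) g ∧
    HasPathDeriv ρ g t
  momentum_eq : ∀ t ∈ J, ∃ g, HasFirstVariation (fun r => hamiltonian F r (S t)) (ρ t) g ∧
    HasPathDeriv S (-g) t

end Geometry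

end HopfCole

end

/-! A nonlinear smooth map of `C^∞(M)` acts on paths through Hadamard's lemma: a smooth family
satisfies `p τ = p t + (τ - t) • ψ τ` with `ψ` smooth and `ψ t = p'(t)`, which reduces the chain
rule to the two-parameter family `p t + a • ψ τ`. Applied to `(δF)⁻¹ ∘ δF = id` it inverts
`δ²F(f)`, and `δ²F(f)` is symmetric because it represents the second derivative of `F` on
two-parameter families.

Let `g₁ = ∂_S H` and `g₂ = ∂_ρ H` at `(ρ, S) = s(η, η*)`. Differentiating `δF(ρ) = δF(η) + δF(η*)`
and `S = δF(η) - δF(η*)` gives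
`∂_η K = δ²F(η) ([δ²F(ρ)]⁻¹ g₂ + g₁)` and `∂_{η*} K = δ²F(η*) ([δ²F(ρ)]⁻¹ g₂ - g₁)`.
Along the flow `ρ' = g₁` and `S' = -g₂`, so the same two relations yield
`δ²F(η) η' = ½ (δ²F(ρ) g₁ - g₂) = -½ δ²F(ρ) ([δ²F(ρ)]⁻¹ g₂ - g₁)`, which is
`η' = σ(η, η*) ∂_{η*} K`; the equation for `η*` is symmetric.

The gradient terms of `H` are differentiated under the integral sign, where joint continuity of
`⟨∇f, ∇g⟩` in point and parameter comes from expressing it in a chart through the inverse Gram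
matrix. -/

noncomputable section

namespace HopfCole

section Calculus

variable {d : ℕ} {M : Type*} [TopologicalSpace M] [ChartedSpace (EuclideanSpace ℝ (Fin d)) M]
  {P Q : Type*} [NormedAddCommGroup P] [NormedSpace ℝ P] [NormedAddCommGroup Q] [NormedSpace ℝ Q]
  {O : Set P} {p q : P → C^∞⟮𝓡 d, M; ℝ⟯}

lemma SmoothFamily.mono {O' : Set P} (hp : SmoothFamily O p) (h : O' ⊆ O) : SmoothFamily O' p :=
  ContMDiffOn.mono hp (Set.prod_mono h le_rfl)

lemma SmoothFamily.congr (hp : SmoothFamily O p) (h : ∀ v ∈ O, q v = p v) : SmoothFamily O q :=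
  ContMDiffOn.congr hp fun v hv => by simp only [h v.1 hv.1]

lemma smoothFamily_const (f : C^∞⟮𝓡 d, M; ℝ⟯) : SmoothFamily O (fun _ => f) :=
  (f.contMDiff.comp contMDiff_snd).contMDiffOn

lemma SmoothFamily.add (hp : SmoothFamily O p) (hq : SmoothFamily O q) :
    SmoothFamily O (fun v => p v + q v) :=
  ContMDiffOn.add hp hq

lemma SmoothFamily.sub (hp : SmoothFamily O p) (hq : SmoothFamily O q) :
    SmoothFamily O (fun v => p v - q v) :=
  ContMDiffOn.sub hp hq

lemma SmoothFamily.smul {c : P → ℝ} (hc : ContDiffOn ℝ ∞ c O) (hp : SmoothFamily O p) :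
    SmoothFamily O (fun v => c v • p v) := by
  have : ContMDiffOn (𝓘(ℝ, P).prod (𝓡 d)) 𝓘(ℝ, ℝ) ∞ (fun z : P × M => c z.1) (O ×ˢ Set.univ) :=
    hc.contMDiffOn.comp contMDiffOn_fst fun v hv => hv.1
  exact ContMDiffOn.smul this hp

lemma SmoothFamily.sum {ι : Type*} {s : Finset ι} {p : ι → P → C^∞⟮𝓡 d, M; ℝ⟯}
    (hp : ∀ i ∈ s, SmoothFamily O (p i)) : SmoothFamily O (fun v => ∑ i ∈ s, p i v) := by
  classical
  induction s using Finset.induction_on with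
  | empty => exact smoothFamily_const 0
  | insert i s hi ih =>
    simp only [Finset.sum_insert hi]
    exact (hp i (s.mem_insert_self i)).add (ih fun j hj => hp j (Finset.mem_insert_of_mem hj))

lemma smoothFamily_linearMap [FiniteDimensional ℝ P] (l : P →ₗ[ℝ] C^∞⟮𝓡 d, M; ℝ⟯) :
    SmoothFamily O l := by
  let b := Module.finBasis ℝ P
  have hsum : SmoothFamily O fun v => ∑ i, b.coord i v • l (b i) := SmoothFamily.sum fun i _ =>
    .smul (b.coord i).toContinuousLinearMap.contDiff.contDiffOn (smoothFamily_const _)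
  refine hsum.congr fun v _ => ?_
  simp only [Module.Basis.coord_apply, ← map_smul, ← map_sum, b.sum_repr]

lemma SmoothFamily.comp {O' : Set Q} {θ : Q → P} (hp : SmoothFamily O p)
    (hθ : ContDiffOn ℝ ∞ θ O') (h : Set.MapsTo θ O' O) : SmoothFamily O' (fun w => p (θ w)) := by
  have : ContMDiffOn (𝓘(ℝ, Q).prod (𝓡 d)) 𝓘(ℝ, P) ∞ (fun z : Q × M => θ z.1) (O' ×ˢ Set.univ) :=
    hθ.contMDiffOn.comp contMDiffOn_fst fun v hv => hv.1
  exact ContMDiffOn.comp (t := O ×ˢ Set.univ) hp (this.prodMk contMDiffOn_snd)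
    fun v hv => ⟨h hv.1, trivial⟩

lemma exists_smoothFamily_coe_eq {f : P → M → ℝ}
    (hf : ContMDiff (𝓘(ℝ, P).prod (𝓡 d)) 𝓘(ℝ, ℝ) ∞ (Function.uncurry f)) :
    ∃ p : P → C^∞⟮𝓡 d, M; ℝ⟯, SmoothFamily Set.univ p ∧ ∀ v, ⇑(p v) = f v :=
  ⟨fun v => ⟨f v, hf.curry_right⟩, hf.contMDiffOn, fun _ => rfl⟩

lemma SmoothFamily.contDiffOn_apply (hp : SmoothFamily O p) (x : M) :
    ContDiffOn ℝ ∞ (fun v => p v x) O := by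
  rw [← contMDiffOn_iff_contDiffOn]
  exact ContMDiffOn.comp (t := O ×ˢ Set.univ) hp (contMDiffOn_id.prodMk contMDiffOn_const)
    fun v hv => ⟨hv, trivial⟩

lemma SmoothFamily.differentiableAt_apply (hO : IsOpen O) (hp : SmoothFamily O p) {v : P}
    (hv : v ∈ O) (x : M) : DifferentiableAt ℝ (fun v => p v x) v :=
  ((hp.contDiffOn_apply x).contDiffAt (hO.mem_nhds hv)).differentiableAt (by simp)

lemma SmoothFamily.contDiffOn_comp_extChartAt_symm [IsManifold (𝓡 d) ∞ M] (hp : SmoothFamily O p)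
    (x₀ : M) :
    ContDiffOn ℝ ∞ (fun z : P × EuclideanSpace ℝ (Fin d) => p z.1 ((extChartAt (𝓡 d) x₀).symm z.2))
      (O ×ˢ (extChartAt (𝓡 d) x₀).target) := by
  rw [← contMDiffOn_iff_contDiffOn, modelWithCornersSelf_prod, ← chartedSpaceSelf_prod]
  exact ContMDiffOn.comp (t := O ×ˢ Set.univ) hp
    (contMDiffOn_fst.prodMk ((contMDiffOn_extChartAt_symm x₀).comp contMDiffOn_snd
      fun z hz => hz.2)) fun v hv => ⟨hv.1, trivial⟩

lemma SmoothFamily.contMDiffOn_fderiv [IsManifold (𝓡 d) ∞ M] (hO : IsOpen O)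
    (hp : SmoothFamily O p) :
    ContMDiffOn (𝓘(ℝ, P).prod (𝓡 d)) 𝓘(ℝ, P →L[ℝ] ℝ) ∞
      (fun z : P × M => fderiv ℝ (fun v => p v z.2) z.1) (O ×ˢ Set.univ) := by
  intro z hz
  have hpz : ContMDiffAt (((𝓘(ℝ, P).prod (𝓡 d)).prod 𝓘(ℝ, P))) 𝓘(ℝ, ℝ) ∞
      (Function.uncurry fun (z : P × M) (v : P) => p v z.2) (z, z.1) :=
    ContMDiffAt.comp (z, z.1) (ContMDiffOn.contMDiffAt hp ((hO.prod isOpen_univ).mem_nhds hz))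
      (contMDiffAt_snd.prodMk (contMDiffAt_snd.comp _ contMDiffAt_fst))
  have := ContMDiffAt.mfderiv (m := ∞) (fun (z : P × M) (v : P) => p v z.2) Prod.fst hpz
    contMDiffAt_fst le_rfl
  simp only [mfderiv_eq_fderiv] at this
  erw [inTangentCoordinates_model_space] at this
  exact this.contMDiffWithinAt

lemma SmoothFamily.exists_hasPathDeriv_linearMap [IsManifold (𝓡 d) ∞ M] (hO : IsOpen O)
    (hp : SmoothFamily O p) {v : P} (hv : v ∈ O) :
    ∃ L : P →ₗ[ℝ] C^∞⟮𝓡 d, M; ℝ⟯, ∀ w, HasPathDeriv (fun ε : ℝ => p (v + ε • w)) (L w) 0 := by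
  have hL (w : P) : ContMDiff (𝓡 d) 𝓘(ℝ, ℝ) ∞ fun x => fderiv ℝ (fun v => p v x) v w := by
    have : ContMDiff (𝓡 d) 𝓘(ℝ, P →L[ℝ] ℝ) ∞ fun x => fderiv ℝ (fun v => p v x) v :=
      contMDiffOn_univ.1 <| ContMDiffOn.comp (t := O ×ˢ Set.univ) (hp.contMDiffOn_fderiv hO)
        (contMDiffOn_const.prodMk contMDiffOn_id) fun x _ => ⟨hv, trivial⟩
    exact this.clm_apply contMDiff_const
  refine ⟨{ toFun := fun w => ⟨_, hL w⟩
            map_add' := fun w w' => by ext x; exact (fderiv ℝ (fun v => p v x) v).map_add w w'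
            map_smul' := fun a w => by ext x; exact (fderiv ℝ (fun v => p v x) v).map_smul a w },
    fun w x => ?_⟩
  exact (hp.differentiableAt_apply hO hv x).hasFDerivAt.hasLineDerivAt w

end Calculus

section Hadamard

lemma contDiffOn_setIntegral {P T F : Type*} [NormedAddCommGroup P] [NormedSpace ℝ P]
    [NormedAddCommGroup T] [NormedSpace ℝ T] [FiniteDimensional ℝ T] [MeasurableSpace T]
    [BorelSpace T] {μ : Measure T} [IsLocallyFiniteMeasure μ] [NormedAddCommGroup F]
    [NormedSpace ℝ F] {S : Set T} (hS : Bornology.IsBounded S) (hSm : MeasurableSet S)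
    {s : Set P} (hs : IsOpen s) {h : P × T → F} (hh : ContDiffOn ℝ ∞ h (s ×ˢ Set.univ)) :
    ContDiffOn ℝ ∞ (fun z => ∫ t in S, h (z, t) ∂μ) s := by
  obtain ⟨r, hr, hSr⟩ := hS.subset_closedBall_lt 0 0
  let χ : ContDiffBump (0 : T) := ⟨r, r + 1, hr, by linarith⟩
  -- The integral is the value at `0` of the convolution of the indicator of `S` with this function.
  let g : P → T → F := fun z t => χ (-t) • h (z, -t)
  have hg : ContDiffOn ℝ ∞ (↿g) (s ×ˢ Set.univ) :=
    (χ.contDiff.comp contDiff_snd.neg).contDiffOn.smul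
      (hh.comp (contDiff_fst.prodMk contDiff_snd.neg).contDiffOn fun z hz => ⟨hz.1, trivial⟩)
  have hg_supp : ∀ z t, z ∈ s → t ∉ Metric.closedBall (0 : T) (r + 1) → g z t = 0 := by
    intro z t _ ht
    have : χ (-t) = 0 := χ.zero_of_le_dist (by simpa using (not_le.1 (by simpa using ht)).le)
    simp only [g, this, zero_smul]
  have hconv := contDiffOn_convolution_right_with_param_comp (n := ⊤) (v := fun _ => (0 : T))
    (f := S.indicator 1) (ContinuousLinearMap.lsmul ℝ ℝ) contDiffOn_const hs
    (isCompact_closedBall (0 : T) (r + 1)) hg_supp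
    ((locallyIntegrable_const (μ := μ) (1 : ℝ)).indicator hSm) hg
  refine hconv.congr fun z _ => ?_
  rw [convolution_def, ← integral_indicator hSm]
  refine integral_congr_ae (.of_forall fun t => ?_)
  by_cases ht : t ∈ S
  · have : χ t = 1 := χ.one_of_mem_closedBall (hSr ht)
    simp [ht, g, this]
  · simp [ht]

variable {d : ℕ} {M : Type*} [TopologicalSpace M] [ChartedSpace (EuclideanSpace ℝ (Fin d)) M]
  [IsManifold (𝓡 d) ∞ M] {p : ℝ → C^∞⟮𝓡 d, M; ℝ⟯}

lemma SmoothFamily.exists_deriv (hp : SmoothFamily Set.univ p) :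
    ∃ p' : ℝ → C^∞⟮𝓡 d, M; ℝ⟯, SmoothFamily Set.univ p' ∧ ∀ t, HasPathDeriv p (p' t) t := by
  have hd : ContMDiff (𝓘(ℝ, ℝ).prod (𝓡 d)) 𝓘(ℝ, ℝ) ∞
      (Function.uncurry fun (t : ℝ) (x : M) => deriv (fun τ => p τ x) t) := by
    have := hp.contMDiffOn_fderiv isOpen_univ
    rw [Set.univ_prod_univ, contMDiffOn_univ] at this
    exact this.clm_apply contMDiff_const
  obtain ⟨p', hp', hp'_eq⟩ := exists_smoothFamily_coe_eq hd
  refine ⟨p', hp', fun t x => ?_⟩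
  rw [hp'_eq]
  exact (hp.differentiableAt_apply isOpen_univ trivial x).hasDerivAt

lemma SmoothFamily.exists_integral_comp_mul (hp : SmoothFamily Set.univ p) :
    ∃ ψ : ℝ → C^∞⟮𝓡 d, M; ℝ⟯, SmoothFamily Set.univ ψ ∧
      ∀ ε x, ψ ε x = ∫ s in (0 : ℝ)..1, p (s * ε) x := by
  have hψ : ContMDiff (𝓘(ℝ, ℝ).prod (𝓡 d)) 𝓘(ℝ, ℝ) ∞
      (Function.uncurry fun (ε : ℝ) (x : M) => ∫ s in (0 : ℝ)..1, p (s * ε) x) := by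
    intro z₀
    set φ := extChartAt (𝓡 d) z₀.2
    have hW : IsOpen ((Set.univ : Set ℝ) ×ˢ φ.target) :=
      isOpen_univ.prod (isOpen_extChartAt_target z₀.2)
    have hI : ContDiffOn ℝ ∞ (fun z : ℝ × EuclideanSpace ℝ (Fin d) =>
        ∫ s in Set.Ioc (0 : ℝ) 1, p (s * z.1) (φ.symm z.2)) (Set.univ ×ˢ φ.target) :=
      contDiffOn_setIntegral (Metric.isBounded_Ioc 0 1) measurableSet_Ioc hW
        (h := fun q => p (q.2 * q.1.1) (φ.symm q.1.2)) <|
        (hp.contDiffOn_comp_extChartAt_symm z₀.2).comp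
          (f := fun q : (ℝ × EuclideanSpace ℝ (Fin d)) × ℝ => (q.2 * q.1.1, q.1.2))
          (ContDiff.contDiffOn (by fun_prop)) fun q hq => ⟨trivial, hq.1.2⟩
    have hz₀ : (z₀.1, φ z₀.2) ∈ (Set.univ : Set ℝ) ×ˢ φ.target :=
      ⟨trivial, mem_extChartAt_target z₀.2⟩
    have hI' := (hI.contDiffAt (hW.mem_nhds hz₀)).contMDiffAt
    rw [modelWithCornersSelf_prod, ← chartedSpaceSelf_prod] at hI'
    have hφ : ContMDiffAt (𝓘(ℝ, ℝ).prod (𝓡 d)) (𝓘(ℝ, ℝ).prod (𝓡 d)) ∞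
        (fun z : ℝ × M => (z.1, φ z.2)) z₀ :=
      contMDiffAt_fst.prodMk ((contMDiffAt_extChartAt (x := z₀.2)).comp z₀ contMDiffAt_snd)
    refine (ContMDiffAt.comp z₀ hI' hφ).congr_of_eventuallyEq ?_
    filter_upwards [continuous_snd.continuousAt.eventually
      (extChartAt_source_mem_nhds (I := 𝓡 d) z₀.2)] with z hz
    simp only [Function.uncurry, Function.comp_apply, φ,
      intervalIntegral.integral_of_le zero_le_one, (extChartAt (𝓡 d) z₀.2).left_inv hz]
  obtain ⟨ψ, hψ, hψ_eq⟩ := exists_smoothFamily_coe_eq hψ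
  exact ⟨ψ, hψ, fun ε x => congrFun (hψ_eq ε) x⟩

lemma SmoothFamily.exists_eq_add_smul_of_univ (hp : SmoothFamily Set.univ p) :
    ∃ ψ : ℝ → C^∞⟮𝓡 d, M; ℝ⟯, SmoothFamily Set.univ ψ ∧ ∀ ε, p ε = p 0 + ε • ψ ε := by
  obtain ⟨p', hp', hpp'⟩ := hp.exists_deriv
  obtain ⟨ψ, hψ, hψ_eq⟩ := hp'.exists_integral_comp_mul
  refine ⟨ψ, hψ, fun ε => ContMDiffMap.ext fun x => ?_⟩
  have hcont : Continuous fun s : ℝ => p' (0 + s • ε) x :=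
    (contDiffOn_univ.1 (hp'.contDiffOn_apply x)).continuous.comp (by fun_prop)
  have hftc := intervalIntegral.integral_unitInterval_deriv_eq_sub (z₀ := 0) (z₁ := ε)
    (f := fun τ => p τ x) (f' := fun τ => p' τ x) hcont.continuousOn fun s _ => hpp' _ x
  simp only [zero_add, smul_eq_mul] at hftc
  change p ε x = p 0 x + ε * ψ ε x
  rw [hψ_eq, hftc, add_sub_cancel]

theorem SmoothFamily.hadamard {O : Set ℝ} (hO : IsOpen O) (hp : SmoothFamily O p) {t : ℝ}
    (ht : t ∈ O) :
    ∃ ψ : ℝ → C^∞⟮𝓡 d, M; ℝ⟯, SmoothFamily Set.univ ψ ∧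
      ∀ᶠ τ in nhds t, p τ = p t + (τ - t) • ψ τ := by
  obtain ⟨r, hr, hrO⟩ := Metric.isOpen_iff.1 hO t ht
  let χ : ContDiffBump (0 : ℝ) := ⟨r / 2, r, by positivity, by linarith⟩
  let θ : ℝ → ℝ := fun ε => t + χ ε * ε
  have hθ : ContDiff ℝ ∞ θ := contDiff_const.add (χ.contDiff.mul contDiff_id)
  have hθO : Set.MapsTo θ Set.univ O := fun ε _ => hrO <| by
    simp only [θ, Metric.mem_ball, dist_self_add_left, Real.norm_eq_abs, abs_mul,
      abs_of_nonneg χ.nonneg]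
    rcases lt_or_ge |ε| r with hε | hε
    · exact (mul_le_of_le_one_left (abs_nonneg _) χ.le_one).trans_lt hε
    · rwa [χ.zero_of_le_dist (by simpa using hε), zero_mul]
  obtain ⟨ψ, hψ, h⟩ := (hp.comp hθ.contDiffOn hθO).exists_eq_add_smul_of_univ
  refine ⟨fun τ => ψ (τ - t), hψ.comp (by fun_prop) (Set.mapsTo_univ _ _), ?_⟩
  have hχ : ∀ᶠ τ in nhds t, χ (τ - t) = 1 :=
    (tendsto_sub_nhds_zero_iff.2 Filter.tendsto_id).eventually χ.eventuallyEq_one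
  filter_upwards [hχ] with τ hτ
  simpa [θ, hτ] using h (τ - t)

end Hadamard

section PathDerivative

variable {d : ℕ} {M : Type*} [TopologicalSpace M] [ChartedSpace (EuclideanSpace ℝ (Fin d)) M]
  {p q : ℝ → C^∞⟮𝓡 d, M; ℝ⟯} {f g φ : C^∞⟮𝓡 d, M; ℝ⟯} {t : ℝ}

lemma HasPathDeriv.unique (hf : HasPathDeriv p f t) (hg : HasPathDeriv p g t) : f = g :=
  ContMDiffMap.ext fun x => (hf x).unique (hg x)

lemma HasPathDeriv.congr (hp : HasPathDeriv p f t) (h : ∀ᶠ τ in nhds t, q τ = p τ) :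
    HasPathDeriv q f t := fun x =>
  (hp x).congr_of_eventuallyEq (h.mono fun τ hτ => by simp only [hτ])

lemma HasPathDeriv.add (hp : HasPathDeriv p f t) (hq : HasPathDeriv q g t) :
    HasPathDeriv (fun τ => p τ + q τ) (f + g) t := fun x => (hp x).add (hq x)

lemma HasPathDeriv.sub (hp : HasPathDeriv p f t) (hq : HasPathDeriv q g t) :
    HasPathDeriv (fun τ => p τ - q τ) (f - g) t := fun x => (hp x).sub (hq x)

lemma hasPathDeriv_const (f : C^∞⟮𝓡 d, M; ℝ⟯) (t : ℝ) : HasPathDeriv (fun _ => f) 0 t :=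
  fun x => hasDerivAt_const t (f x)

lemma hasPathDeriv_add_smul (f φ : C^∞⟮𝓡 d, M; ℝ⟯) :
    HasPathDeriv (fun ε => f + ε • φ) φ 0 := fun x => by
  simpa using ((hasDerivAt_id (0 : ℝ)).mul_const (φ x)).const_add (f x)

lemma smoothFamily_add_smul (f φ : C^∞⟮𝓡 d, M; ℝ⟯) :
    SmoothFamily (Set.univ : Set ℝ) (fun ε => f + ε • φ) :=
  (smoothFamily_const f).add (SmoothFamily.smul contDiffOn_id (smoothFamily_const φ))

lemma hasDerivAt_of_eventually_eq_add_mul {φ c : ℝ → ℝ} {t : ℝ} (hc : ContinuousAt c t)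
    (h : ∀ᶠ τ in nhds t, φ τ = φ t + (τ - t) * c τ) : HasDerivAt φ (c t) t := by
  refine hasDerivAt_iff_tendsto_slope.2 (hc.mono_left inf_le_left |>.congr' ?_)
  filter_upwards [nhdsWithin_le_nhds h, self_mem_nhdsWithin] with τ hτ hne
  rw [slope_def_field, hτ, add_sub_cancel_left, mul_div_cancel_left₀ _ (sub_ne_zero.2 hne)]

lemma SmoothFamily.hasPathDeriv (hq : SmoothFamily Set.univ q)
    (h : ∀ᶠ τ in nhds t, p τ = p t + (τ - t) • q τ) : HasPathDeriv p (q t) t := fun x =>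
  hasDerivAt_of_eventually_eq_add_mul
    (contDiffOn_univ.1 (hq.contDiffOn_apply x)).continuous.continuousAt
    (h.mono fun _ hτ => congrArg (· x) hτ)

variable [IsManifold (𝓡 d) ∞ M]

lemma SmoothFamily.exists_hasPathDeriv {O : Set ℝ} (hO : IsOpen O) (hp : SmoothFamily O p)
    (ht : t ∈ O) : ∃ g, HasPathDeriv p g t :=
  let ⟨ψ, hψ, h⟩ := hp.hadamard hO ht
  ⟨ψ t, hψ.hasPathDeriv h⟩

end PathDerivative

section DirectionalDerivative

variable {d : ℕ} {M : Type*} [TopologicalSpace M] [ChartedSpace (EuclideanSpace ℝ (Fin d)) M]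
  {U V : Set C^∞⟮𝓡 d, M; ℝ⟯} {Φ Ψ : C^∞⟮𝓡 d, M; ℝ⟯ → C^∞⟮𝓡 d, M; ℝ⟯} {f g φ : C^∞⟮𝓡 d, M; ℝ⟯}

lemma dirDeriv_eq (h : HasPathDeriv (fun ε : ℝ => Φ (f + ε • φ)) g 0) : dirDeriv Φ f φ = g := by
  have hex : ∃ g, HasPathDeriv (fun ε : ℝ => Φ (f + ε • φ)) g 0 := ⟨g, h⟩
  rw [dirDeriv, dif_pos hex]
  exact hex.choose_spec.unique h

lemma IsOpenSmooth.isOpen_setOf_add_smul_mem (hU : IsOpenSmooth U) (f φ : C^∞⟮𝓡 d, M; ℝ⟯) :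
    IsOpen {ε : ℝ | f + ε • φ ∈ U} := by
  simpa using hU ℝ Set.univ _ isOpen_univ (smoothFamily_add_smul f φ)

variable [IsManifold (𝓡 d) ∞ M]

lemma SmoothMapOn.exists_hasPathDeriv_linearMap (hΦ : SmoothMapOn U Φ) (hU : IsOpenSmooth U)
    {P : Type} [NormedAddCommGroup P] [NormedSpace ℝ P] [FiniteDimensional ℝ P]
    {p : P → C^∞⟮𝓡 d, M; ℝ⟯} (hp : SmoothFamily Set.univ p) {v : P} (hv : p v ∈ U) :
    ∃ L : P →ₗ[ℝ] C^∞⟮𝓡 d, M; ℝ⟯, ∀ w, HasPathDeriv (fun ε : ℝ => Φ (p (v + ε • w))) (L w) 0 := by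
  have hV := hU P Set.univ p isOpen_univ hp
  have hΦp := hΦ P _ p hV (hp.mono (Set.subset_univ _)) fun v hv => hv.2
  exact hΦp.exists_hasPathDeriv_linearMap hV ⟨trivial, hv⟩

lemma SmoothMapOn.isLinearMap_dirDeriv (hΦ : SmoothMapOn U Φ) (hU : IsOpenSmooth U)
    (hf : f ∈ U) : IsLinearMap ℝ (dirDeriv Φ f) := by
  -- Additivity and homogeneity only involve two directions, that is a two-parameter family.
  have hplane (φ ψ : C^∞⟮𝓡 d, M; ℝ⟯) : ∃ L : ℝ × ℝ →ₗ[ℝ] C^∞⟮𝓡 d, M; ℝ⟯,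
      ∀ a b : ℝ, dirDeriv Φ f (a • φ + b • ψ) = L (a, b) := by
    have hp : SmoothFamily Set.univ fun v : ℝ × ℝ => f + (v.1 • φ + v.2 • ψ) :=
      (smoothFamily_const f).add ((SmoothFamily.smul contDiffOn_fst (smoothFamily_const φ)).add
        (SmoothFamily.smul contDiffOn_snd (smoothFamily_const ψ)))
    obtain ⟨L, hL⟩ := hΦ.exists_hasPathDeriv_linearMap hU hp (v := 0) (by simpa using hf)
    refine ⟨L, fun a b => dirDeriv_eq ?_⟩
    simpa [smul_add, mul_smul] using hL (a, b)
  constructor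
  · intro φ ψ
    obtain ⟨L, hL⟩ := hplane φ ψ
    have := map_add L (1, 0) (0, 1)
    simpa [← hL] using this
  · intro a φ
    obtain ⟨L, hL⟩ := hplane φ 0
    have := map_smul L a (1, 0)
    simpa [← hL] using this

theorem SmoothMapOn.hasPathDeriv_comp (hΦ : SmoothMapOn U Φ) (hU : IsOpenSmooth U)
    {c : ℝ → C^∞⟮𝓡 d, M; ℝ⟯} {O : Set ℝ} (hO : IsOpen O) (hc : SmoothFamily O c) {t : ℝ}
    (ht : t ∈ O) (hcU : c t ∈ U) (hφ : HasPathDeriv c φ t) :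
    HasPathDeriv (fun τ => Φ (c τ)) (dirDeriv Φ (c t) φ) t := by
  obtain ⟨ψ, hψ, hcψ⟩ := hc.hadamard hO ht
  obtain rfl : ψ t = φ := (hψ.hasPathDeriv hcψ).unique hφ
  have hp : SmoothFamily Set.univ fun v : ℝ × ℝ => c t + v.1 • ψ (t + v.2) :=
    (smoothFamily_const (c t)).add (SmoothFamily.smul contDiffOn_fst
      (hψ.comp (contDiffOn_const.add contDiffOn_snd) (Set.mapsTo_univ _ _)))
  obtain ⟨L, hL⟩ := hΦ.exists_hasPathDeriv_linearMap hU hp (v := 0) (by simpa using hcU)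
  -- The path is the diagonal of this two-parameter family, which is a line when `v.2 = 0` and
  -- is constant when `v.1 = 0`.
  have hline : dirDeriv Φ (c t) (ψ t) = L (1, 0) := dirDeriv_eq (by simpa using hL (1, 0))
  have hconst : L (0, 1) = 0 := (hL (0, 1)).unique (by simpa using hasPathDeriv_const _ _)
  have hdiag : L (1, 1) = dirDeriv Φ (c t) (ψ t) := by
    rw [hline, ← add_zero (L (1, 0)), ← hconst, ← map_add, Prod.mk_add_mk, add_zero, zero_add]
  have hΦc : HasPathDeriv (fun ε => Φ (c t + ε • ψ (t + ε))) (L (1, 1)) (t - t) := by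
    simpa using hL (1, 1)
  rw [hdiag] at hΦc
  refine HasPathDeriv.congr (fun x => (hΦc x).comp_sub_const t t) (hcψ.mono fun τ hτ => ?_)
  simp only [hτ, add_sub_cancel]

lemma SmoothMapOn.hasPathDeriv_add_smul (hΦ : SmoothMapOn U Φ) (hU : IsOpenSmooth U)
    (hf : f ∈ U) (φ : C^∞⟮𝓡 d, M; ℝ⟯) :
    HasPathDeriv (fun ε : ℝ => Φ (f + ε • φ)) (dirDeriv Φ f φ) 0 := by
  simpa using hΦ.hasPathDeriv_comp hU isOpen_univ (smoothFamily_add_smul f φ) (t := 0) trivial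
    (by simpa using hf) (HopfCole.hasPathDeriv_add_smul f φ)

lemma SmoothMapOn.dirDeriv_dirDeriv_of_leftInvOn (hΦ : SmoothMapOn U Φ) (hU : IsOpenSmooth U)
    (hΨ : SmoothMapOn V Ψ) (hV : IsOpenSmooth V) (hUV : Set.MapsTo Φ U V)
    (hinv : Set.LeftInvOn Ψ Φ U) (hf : f ∈ U) (φ : C^∞⟮𝓡 d, M; ℝ⟯) :
    dirDeriv Ψ (Φ f) (dirDeriv Φ f φ) = φ := by
  set O : Set ℝ := {ε | f + ε • φ ∈ U}
  have hO : IsOpen O := hU.isOpen_setOf_add_smul_mem f φ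
  have h0 : (0 : ℝ) ∈ O := by simpa [O] using hf
  have hΦf : SmoothFamily O fun ε : ℝ => Φ (f + ε • φ) :=
    hΦ ℝ O _ hO ((smoothFamily_add_smul f φ).mono (Set.subset_univ _)) fun _ hε => hε
  have hΨΦ := hΨ.hasPathDeriv_comp hV hO hΦf h0 (hUV h0) (hΦ.hasPathDeriv_add_smul hU hf φ)
  simp only [zero_smul, add_zero] at hΨΦ
  refine hΨΦ.unique ((HopfCole.hasPathDeriv_add_smul f φ).congr ?_)
  filter_upwards [hO.mem_nhds h0] with ε hε using hinv hε

end DirectionalDerivative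

section Volume

open Metric Set Filter Topology
open scoped NNReal ENNReal

section

variable {E : Type*} [NormedAddCommGroup E] [NormedSpace ℝ E]
  {H : Type*} [TopologicalSpace H] {I : ModelWithCorners ℝ E H}
  {M : Type*} [PseudoEMetricSpace M] [ChartedSpace H M]
  [RiemannianBundle (fun x : M => TangentSpace I x)] [IsRiemannianManifold I M]

lemma lipschitzOnWith_of_enorm_mfderiv_le {F : Type*} [NormedAddCommGroup F] [NormedSpace ℝ F]
    {f : F → M} {s : Set F} {C : ℝ≥0} (hs : IsOpen s) (hsc : Convex ℝ s)
    (hf : ContMDiffOn 𝓘(ℝ, F) I 1 f s)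
    (hC : ∀ y ∈ s, ∀ v : F, ‖mfderiv 𝓘(ℝ, F) I f y v‖ₑ ≤ C * ‖v‖ₑ) : LipschitzOnWith C f s := by
  intro y hy z hz
  let η : ℝ → F := AffineMap.lineMap y z
  have hη : MapsTo η (Icc 0 1) s := fun t ht => hsc.segment_subset hy hz
    (segment_eq_image_lineMap ℝ y z ▸ mem_image_of_mem _ ht)
  have hη_deriv (t : ℝ) : HasDerivAt η (z - y) t := AffineMap.hasDerivAt_lineMap
  have hfη : ContMDiffOn 𝓘(ℝ, ℝ) I 1 (f ∘ η) (Icc 0 1) :=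
    hf.comp (AffineMap.contDiff_lineMap y z).contMDiff.contMDiffOn hη
  have hspeed (t : ℝ) (ht : t ∈ Ioo 0 1) :
      ‖mfderiv 𝓘(ℝ, ℝ) I (f ∘ η) t 1‖ₑ ≤ C * edist y z := by
    have hηt := hη (Ioo_subset_Icc_self ht)
    have hft : MDifferentiableAt 𝓘(ℝ, F) I f (η t) :=
      (hf.contMDiffAt (hs.mem_nhds hηt)).mdifferentiableAt one_ne_zero
    rw [mfderiv_comp_apply t hft (hη_deriv t).differentiableAt.mdifferentiableAt,
      mfderiv_eq_fderiv, edist_comm, edist_eq_enorm_sub]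
    have : fderiv ℝ η t 1 = z - y := (hη_deriv t).deriv
    exact this ▸ hC (η t) hηt _
  calc edist (f y) (f z) = riemannianEDist I (f y) (f z) := IsRiemannianManifold.out _ _
    _ ≤ pathELength I (f ∘ η) 0 1 :=
      riemannianEDist_le_pathELength hfη (by simp [η]) (by simp [η]) zero_le_one
    _ = ∫⁻ t in Ioo 0 1, ‖mfderiv 𝓘(ℝ, ℝ) I (f ∘ η) t 1‖ₑ := pathELength_eq_lintegral_mfderiv_Ioo
    _ ≤ ∫⁻ _ in Ioo (0 : ℝ) 1, C * edist y z := setLIntegral_mono' measurableSet_Ioo hspeed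
    _ = C * edist y z := by simp

attribute [local instance] normedAddCommGroupTangentSpaceVectorSpace
  normedSpaceTangentSpaceVectorSpace

lemma exists_lipschitzOnWith_extChartAt_symm [IsManifold I 1 M] [I.Boundaryless]
    [IsContinuousRiemannianBundle E (fun x : M => TangentSpace I x)] (x : M) :
    ∃ C : ℝ≥0, ∃ r > 0, LipschitzOnWith C (extChartAt I x).symm (ball (extChartAt I x x) r) := by
  obtain ⟨C, -, hC⟩ := eventually_enorm_mfderivWithin_symm_extChartAt_lt I x
  rw [I.range_eq_univ, nhdsWithin_univ] at hC
  obtain ⟨r, hr, hball⟩ := Metric.eventually_nhds_iff_ball.1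
    (hC.and (extChartAt_target_mem_nhds (I := I) x))
  refine ⟨C, r, hr, lipschitzOnWith_of_enorm_mfderiv_le isOpen_ball (convex_ball _ _)
    ((contMDiffOn_extChartAt_symm x).mono fun y hy => (hball y hy).2) fun y hy v => ?_⟩
  have hCy := (hball y hy).1.le
  rw [mfderivWithin_univ] at hCy
  exact ContinuousLinearMap.le_of_opENorm_le _ hCy v

end

lemma isContinuousRiemannianBundle_of_isContMDiff {EB : Type*} [NormedAddCommGroup EB]
    [NormedSpace ℝ EB] {HB : Type*} [TopologicalSpace HB] (IB : ModelWithCorners ℝ EB HB)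
    (n : ℕ∞ω) {B : Type*} [TopologicalSpace B] [ChartedSpace HB B] {F : Type*}
    [NormedAddCommGroup F] [NormedSpace ℝ F] {E : B → Type*} [TopologicalSpace (TotalSpace F E)]
    [∀ x, NormedAddCommGroup (E x)] [∀ x, InnerProductSpace ℝ (E x)] [FiberBundle F E]
    [VectorBundle ℝ F E] [h : IsContMDiffRiemannianBundle IB n F E] :
    IsContinuousRiemannianBundle F E :=
  let ⟨g, hg, hinner⟩ := h.exists_contMDiff
  ⟨g, hg.continuous, hinner⟩

lemma isLocallyFiniteMeasure_vol {d : ℕ} {M : Type*} [EMetricSpace M] [MeasurableSpace M]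
    [BorelSpace M] [ChartedSpace (EuclideanSpace ℝ (Fin d)) M] [IsManifold (𝓡 d) 1 M]
    [RiemannianBundle (fun x : M => TangentSpace (𝓡 d) x)] [IsRiemannianManifold (𝓡 d) M]
    [IsContinuousRiemannianBundle (EuclideanSpace ℝ (Fin d))
      (fun x : M => TangentSpace (𝓡 d) x)] : IsLocallyFiniteMeasure (vol d M) where
  finiteAtNhds x := by
    obtain ⟨C, r, hr, hC⟩ := exists_lipschitzOnWith_extChartAt_symm (I := 𝓡 d) x
    set φ := extChartAt (𝓡 d) x
    refine ⟨φ.symm '' ball (φ x) r, ?_, ?_⟩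
    · filter_upwards [(continuousAt_extChartAt (I := 𝓡 d) x).preimage_mem_nhds (ball_mem_nhds _ hr),
        extChartAt_source_mem_nhds (I := 𝓡 d) x] with y hy hy'
      exact ⟨φ y, hy, φ.left_inv hy'⟩
    · have hH : (μH[(d : ℝ)] : Measure M) (φ.symm '' ball (φ x) r) < ⊤ :=
        (hC.hausdorffMeasure_image_le (Nat.cast_nonneg d)).trans_lt
          (ENNReal.mul_lt_top (by simp) measure_ball_lt_top)
      rw [vol, Measure.euclideanHausdorffMeasure_def, Measure.smul_apply]
      exact ENNReal.mul_lt_top (by simp) hH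

end Volume

section Gradient

variable {d : ℕ} {M : Type*} [EMetricSpace M] [ChartedSpace (EuclideanSpace ℝ (Fin d)) M]
  {P : Type*} [NormedAddCommGroup P] [NormedSpace ℝ P] {O : Set P} {A B : P → C^∞⟮𝓡 d, M; ℝ⟯}

lemma mdifferentiableAt_coe (f : C^∞⟮𝓡 d, M; ℝ⟯) (x : M) :
    MDifferentiableAt (𝓡 d) 𝓘(ℝ, ℝ) f x :=
  f.contMDiff.contMDiffAt.mdifferentiableAt (by simp)

section Algebra

variable [RiemannianBundle (fun x : M => TangentSpace (𝓡 d) x)] (f g : C^∞⟮𝓡 d, M; ℝ⟯)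

lemma inner_grad (x : M) (v : TangentSpace (𝓡 d) x) :
    inner ℝ (grad f x) v = mvfderiv (𝓡 d) f x v := by
  rw [grad, InnerProductSpace.toDual_symm_apply]

lemma grad_add (x : M) : grad (f + g) x = grad f x + grad g x := by
  simp only [grad, ContMDiffMap.coe_add,
    mvfderiv_add (mdifferentiableAt_coe f x) (mdifferentiableAt_coe g x), map_add]

lemma grad_smul (c : ℝ) (x : M) : grad (c • f) x = c • grad f x := by
  have : mvfderiv (𝓡 d) (c • ⇑f) x = c • mvfderiv (𝓡 d) f x := by
    have := mvfderiv_smul (I := 𝓡 d) (a := fun _ : M => c) mdifferentiableAt_const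
      (mdifferentiableAt_coe f x)
    rw [mvfderiv_const, ContinuousLinearMap.zero_smulRight, add_zero] at this
    exact this
  rw [grad, ContMDiffMap.coe_smul, this, map_smul, grad]

lemma grad_zero (x : M) : grad (0 : C^∞⟮𝓡 d, M; ℝ⟯) x = 0 := by
  simpa using grad_smul (0 : C^∞⟮𝓡 d, M; ℝ⟯) 0 x

end Algebra

variable [IsManifold (𝓡 d) ∞ M]

lemma SmoothFamily.continuousAt_fderiv_comp_extChartAt_symm (hO : IsOpen O)
    (hA : SmoothFamily O A) {v₀ : P} (hv : v₀ ∈ O) (x₀ : M) :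
    ContinuousAt (fun z : P × M => fderiv ℝ (A z.1 ∘ (extChartAt (𝓡 d) x₀).symm)
      (extChartAt (𝓡 d) x₀ z.2)) (v₀, x₀) := by
  set φ := extChartAt (𝓡 d) x₀
  let a := fun z : P × EuclideanSpace ℝ (Fin d) => A z.1 (φ.symm z.2)
  have ha : ContDiffOn ℝ ∞ a (O ×ˢ φ.target) := hA.contDiffOn_comp_extChartAt_symm x₀
  have hopen : IsOpen (O ×ˢ φ.target) := hO.prod (isOpen_extChartAt_target x₀)
  have hpartial : ContinuousAt (fun z => (fderiv ℝ a z).comp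
      (ContinuousLinearMap.inr ℝ P (EuclideanSpace ℝ (Fin d)))) (v₀, φ x₀) :=
    ((ha.continuousOn_fderiv_of_isOpen hopen (by simp)).continuousAt
      (hopen.mem_nhds ⟨hv, mem_extChartAt_target x₀⟩)).clm_comp continuousAt_const
  have hφ : ContinuousAt (fun z : P × M => (z.1, φ z.2)) (v₀, x₀) :=
    continuousAt_fst.prodMk (ContinuousAt.comp (f := Prod.snd)
      (continuousAt_extChartAt (I := 𝓡 d) x₀) continuousAt_snd)
  refine (ContinuousAt.comp (f := fun z : P × M => (z.1, φ z.2)) hpartial hφ).congr ?_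
  filter_upwards [continuousAt_snd.eventually (extChartAt_source_mem_nhds (I := 𝓡 d) x₀),
    continuousAt_fst.eventually (hO.mem_nhds hv)] with z hz hzO
  have hd : DifferentiableAt ℝ a (z.1, φ z.2) :=
    (ha.contDiffAt (hopen.mem_nhds (Set.mk_mem_prod hzO (φ.map_source hz)))).differentiableAt
      (by simp)
  exact (hd.hasFDerivAt.comp (φ z.2) (hasFDerivAt_prodMk_right z.1 (φ z.2))).fderiv.symm

/-- The identification of the model space with `T_x M` given by the chart at `x₀`; it is the zero
map when `x` lies outside the domain of this chart. -/
def chartFrame (x₀ x : M) : EuclideanSpace ℝ (Fin d) →L[ℝ] TangentSpace (𝓡 d) x :=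
  (trivializationAt (EuclideanSpace ℝ (Fin d)) (fun x : M => TangentSpace (𝓡 d) x) x₀).symmL ℝ x

lemma bijective_chartFrame {x₀ x : M}
    (hx : x ∈ (chartAt (EuclideanSpace ℝ (Fin d)) x₀).source) :
    Function.Bijective (chartFrame (d := d) x₀ x) := by
  set e := trivializationAt (EuclideanSpace ℝ (Fin d)) (fun x : M => TangentSpace (𝓡 d) x) x₀
  have hx' : x ∈ e.baseSet := by simpa [e] using hx
  exact ⟨Function.LeftInverse.injective (e.continuousLinearMapAt_symmL (R := ℝ) hx'),
    Function.RightInverse.surjective (e.symmL_continuousLinearMapAt (R := ℝ) hx')⟩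

lemma mvfderiv_chartFrame (f : C^∞⟮𝓡 d, M; ℝ⟯) {x₀ x : M}
    (hx : x ∈ (chartAt (EuclideanSpace ℝ (Fin d)) x₀).source) (w : EuclideanSpace ℝ (Fin d)) :
    mvfderiv (𝓡 d) f x (chartFrame x₀ x w) =
      fderiv ℝ (f ∘ (extChartAt (𝓡 d) x₀).symm) (extChartAt (𝓡 d) x₀ x) w := by
  set φ := extChartAt (𝓡 d) x₀
  have hxφ : x ∈ φ.source := by simpa [φ] using hx
  have hφ : MDifferentiableAt 𝓘(ℝ, EuclideanSpace ℝ (Fin d)) (𝓡 d) φ.symm (φ x) :=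
    ((contMDiffOn_extChartAt_symm (n := ∞) x₀).contMDiffAt
      (extChartAt_target_mem_nhds' (φ.map_source hxφ))).mdifferentiableAt (by simp)
  have hf := mdifferentiableAt_coe f (φ.symm (φ x))
  have hcomp := mfderiv_comp_apply (φ x) hf hφ w
  rw [mfderiv_eq_fderiv, φ.left_inv hxφ] at hcomp
  rw [chartFrame, TangentBundle.symmL_trivializationAt hx, ModelWithCorners.range_eq_univ,
    mfderivWithin_univ]
  exact hcomp.symm

variable [RiemannianBundle (fun x : M => TangentSpace (𝓡 d) x)]

/-- The Riemannian metric at `x` in the coordinates of the chart at `x₀`, as a map from the model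
space to its dual; the inner product of two gradients is computed from its inverse. -/
def gram (x₀ x : M) : EuclideanSpace ℝ (Fin d) →L[ℝ] EuclideanSpace ℝ (Fin d) →L[ℝ] ℝ :=
  (innerSL ℝ (E := TangentSpace (𝓡 d) x)).bilinearComp (chartFrame x₀ x) (chartFrame x₀ x)

lemma gram_apply (x₀ x : M) (u w : EuclideanSpace ℝ (Fin d)) :
    gram x₀ x u w = inner ℝ (chartFrame x₀ x u) (chartFrame x₀ x w) :=
  rfl

lemma isInvertible_gram {x₀ x : M} (hx : x ∈ (chartAt (EuclideanSpace ℝ (Fin d)) x₀).source) :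
    (gram (d := d) x₀ x).IsInvertible := by
  have hinj : Function.Injective (gram (d := d) x₀ x) := by
    refine (injective_iff_map_eq_zero _).2 fun u hu => (bijective_chartFrame hx).1 ?_
    have : inner ℝ (chartFrame x₀ x u) (chartFrame x₀ x u) = 0 := by rw [← gram_apply, hu]; rfl
    rw [inner_self_eq_zero.1 this, map_zero]
  have hdim : Module.finrank ℝ (EuclideanSpace ℝ (Fin d)) =
      Module.finrank ℝ (EuclideanSpace ℝ (Fin d) →L[ℝ] ℝ) := by
    rw [← LinearMap.toContinuousLinearMap.finrank_eq]
    exact (Subspace.dual_finrank_eq (K := ℝ)).symm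
  exact ⟨(LinearMap.linearEquivOfInjective (gram (d := d) x₀ x).toLinearMap
    hinj hdim).toContinuousLinearEquiv, rfl⟩

lemma inner_grad_grad_eq_gram_inverse (f g : C^∞⟮𝓡 d, M; ℝ⟯) {x₀ x : M}
    (hx : x ∈ (chartAt (EuclideanSpace ℝ (Fin d)) x₀).source) :
    inner ℝ (grad f x) (grad g x) =
      fderiv ℝ (f ∘ (extChartAt (𝓡 d) x₀).symm) (extChartAt (𝓡 d) x₀ x) ((gram x₀ x).inverse
        (fderiv ℝ (g ∘ (extChartAt (𝓡 d) x₀).symm) (extChartAt (𝓡 d) x₀ x))) := by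
  obtain ⟨u, hu⟩ := (bijective_chartFrame hx).2 (grad g x)
  have hgram : gram x₀ x u =
      fderiv ℝ (g ∘ (extChartAt (𝓡 d) x₀).symm) (extChartAt (𝓡 d) x₀ x) := by
    ext w
    rw [gram_apply, hu, inner_grad, mvfderiv_chartFrame g hx]
  rw [(isInvertible_gram hx).inverse_apply_eq.2 hgram.symm, ← mvfderiv_chartFrame f hx, hu,
    inner_grad]

variable [IsContinuousRiemannianBundle (EuclideanSpace ℝ (Fin d))
  (fun x : M => TangentSpace (𝓡 d) x)]

lemma continuousOn_gram (x₀ : M) :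
    ContinuousOn (gram (d := d) x₀) (chartAt (EuclideanSpace ℝ (Fin d)) x₀).source := by
  set e := trivializationAt (EuclideanSpace ℝ (Fin d)) (fun x : M => TangentSpace (𝓡 d) x) x₀
  have hframe (u : EuclideanSpace ℝ (Fin d)) :
      ContinuousOn (fun x : M => TotalSpace.mk' (EuclideanSpace ℝ (Fin d))
        (E := fun x : M => TangentSpace (𝓡 d) x) x (chartFrame x₀ x u)) e.baseSet := by
    refine (e.continuousOn_symm_prodMk_left (v := u)).congr fun x hx => ?_
    rw [chartFrame, Trivialization.symmL_apply _ hx]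
    exact Trivialization.mk_symm _ hx u
  exact continuousOn_clm_apply.2 fun u => continuousOn_clm_apply.2 fun w =>
    (hframe u).inner_bundle (hframe w)

theorem SmoothFamily.continuousOn_inner_grad (hO : IsOpen O) (hA : SmoothFamily O A)
    (hB : SmoothFamily O B) :
    ContinuousOn (fun z : P × M => inner ℝ (grad (A z.1) z.2) (grad (B z.1) z.2))
      (O ×ˢ Set.univ) := by
  rintro ⟨v₀, x₀⟩ ⟨hv, -⟩
  have hsrc := chart_source_mem_nhds (EuclideanSpace ℝ (Fin d)) x₀
  have hinv : ContinuousAt (fun z : P × M => (gram (d := d) x₀ z.2).inverse) (v₀, x₀) := by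
    have hinv₀ : ContinuousAt (fun x : M => (gram (d := d) x₀ x).inverse) x₀ :=
      ((isInvertible_gram (mem_chart_source _ x₀)).contDiffAt_map_inverse
        (n := 0)).continuousAt.comp ((continuousOn_gram x₀).continuousAt hsrc)
    exact ContinuousAt.comp (f := Prod.snd) (x := (v₀, x₀)) hinv₀ continuousAt_snd
  refine ContinuousAt.continuousWithinAt <|
    ((hA.continuousAt_fderiv_comp_extChartAt_symm hO hv x₀).clm_apply (hinv.clm_apply
      (hB.continuousAt_fderiv_comp_extChartAt_symm hO hv x₀))).congr ?_
  filter_upwards [continuousAt_snd.eventually hsrc] with z hz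
  exact (inner_grad_grad_eq_gram_inverse _ _ hz).symm

lemma continuous_inner_grad_mul (w f g : C^∞⟮𝓡 d, M; ℝ⟯) :
    Continuous fun x => inner ℝ (grad f x) (grad g x) * w x := by
  have h := (smoothFamily_const (O := (Set.univ : Set ℝ)) f).continuousOn_inner_grad isOpen_univ
    (smoothFamily_const g)
  have hinner : Continuous fun x => inner ℝ (grad f x) (grad g x) :=
    (h.comp_continuous (Continuous.prodMk_right (0 : ℝ)) fun _ => ⟨trivial, trivial⟩).congr
      fun x => rfl
  exact hinner.mul w.contMDiff.continuous

end Gradient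

section Integral

lemma hasDerivAt_integral_of_eventually_eq_add_mul {X : Type*} [TopologicalSpace X]
    [CompactSpace X] [MeasurableSpace X] [OpensMeasurableSpace X] {μ : Measure X}
    [IsFiniteMeasureOnCompacts μ] {q k : ℝ → X → ℝ} {O : Set ℝ} {t : ℝ} (hO : IsOpen O)
    (ht : t ∈ O) (hq : Continuous (q t)) (hk : ContinuousOn (Function.uncurry k) (O ×ˢ Set.univ))
    (h : ∀ᶠ τ in nhds t, ∀ x, q τ x = q t x + (τ - t) * k τ x) :
    HasDerivAt (fun τ => ∫ x, q τ x ∂μ) (∫ x, k t x ∂μ) t := by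
  have hk_int {τ : ℝ} (hτ : τ ∈ O) : Integrable (k τ) μ := by
    have : Continuous (k τ) := hk.comp_continuous (Continuous.prodMk_right τ) fun x => ⟨hτ, trivial⟩
    exact this.integrable_of_hasCompactSupport (.of_compactSpace _)
  have hc : ContinuousOn (fun τ => ∫ x, k τ x ∂μ) O :=
    continuousOn_integral_of_compact_support isCompact_univ hk fun _ x _ hx =>
      (hx trivial).elim
  refine hasDerivAt_of_eventually_eq_add_mul (hc.continuousAt (hO.mem_nhds ht)) ?_
  filter_upwards [h, hO.mem_nhds ht] with τ hτ hτO
  rw [← integral_const_mul, ← integral_add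
    (hq.integrable_of_hasCompactSupport (.of_compactSpace _)) ((hk_int hτO).const_mul _)]
  exact integral_congr_ae (.of_forall hτ)

end Integral

section Pairing

variable {d : ℕ} {M : Type*} [EMetricSpace M] [MeasurableSpace M] [BorelSpace M]
  [ChartedSpace (EuclideanSpace ℝ (Fin d)) M]

lemma pairing_comm (f g : C^∞⟮𝓡 d, M; ℝ⟯) : pairing f g = pairing g f := by
  simp only [pairing, mul_comm]

lemma pairing_smul_left (c : ℝ) (f g : C^∞⟮𝓡 d, M; ℝ⟯) :
    pairing (c • f) g = c * pairing f g := by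
  simp only [pairing, ← integral_const_mul, ContMDiffMap.coe_smul, Pi.smul_apply, smul_eq_mul,
    mul_assoc]

lemma pairing_zero_right (f : C^∞⟮𝓡 d, M; ℝ⟯) : pairing f 0 = 0 := by
  simp only [pairing, ContMDiffMap.coe_zero, Pi.zero_apply, mul_zero, integral_zero]

variable [CompactSpace M] [IsFiniteMeasureOnCompacts (vol d M)]

lemma pairing_add_left (f g h : C^∞⟮𝓡 d, M; ℝ⟯) :
    pairing (f + g) h = pairing f h + pairing g h := by
  have hint (f g : C^∞⟮𝓡 d, M; ℝ⟯) : Integrable (fun x => f x * g x) (vol d M) :=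
    (f.contMDiff.continuous.mul g.contMDiff.continuous).integrable_of_hasCompactSupport
      (.of_compactSpace _)
  simp only [pairing, ← integral_add (hint f h) (hint g h), ContMDiffMap.coe_add, Pi.add_apply,
    add_mul]

lemma pairing_sub_left (f g h : C^∞⟮𝓡 d, M; ℝ⟯) :
    pairing (f - g) h = pairing f h - pairing g h := by
  rw [eq_sub_iff_add_eq, ← pairing_add_left, sub_add_cancel]

lemma pairing_add_right (f g h : C^∞⟮𝓡 d, M; ℝ⟯) :
    pairing f (g + h) = pairing f g + pairing f h := by
  simp only [pairing_comm f, pairing_add_left]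

lemma pairing_sub_right (f g h : C^∞⟮𝓡 d, M; ℝ⟯) :
    pairing f (g - h) = pairing f g - pairing f h := by
  simp only [pairing_comm f, pairing_sub_left]

lemma SmoothFamily.hasDerivAt_pairing [IsManifold (𝓡 d) ∞ M] {p : ℝ → C^∞⟮𝓡 d, M; ℝ⟯}
    {O : Set ℝ} (hO : IsOpen O) (hp : SmoothFamily O p) {t : ℝ} (ht : t ∈ O)
    {g : C^∞⟮𝓡 d, M; ℝ⟯} (hg : HasPathDeriv p g t) (f : C^∞⟮𝓡 d, M; ℝ⟯) :
    HasDerivAt (fun τ => pairing (p τ) f) (pairing g f) t := by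
  obtain ⟨ψ, hψ, h⟩ := hp.hadamard hO ht
  obtain rfl : ψ t = g := (hψ.hasPathDeriv h).unique hg
  refine hasDerivAt_integral_of_eventually_eq_add_mul (k := fun τ x => ψ τ x * f x) isOpen_univ
    trivial ((p t).contMDiff.continuous.mul f.contMDiff.continuous)
    (ContinuousOn.mul (ContMDiffOn.continuousOn hψ)
      (f.contMDiff.continuous.comp continuous_snd).continuousOn) (h.mono fun τ hτ x => ?_)
  rw [hτ]
  exact (add_mul _ _ _).trans (congrArg _ (mul_assoc _ _ _))

end Pairing

section DirichletForm

variable {d : ℕ} {M : Type*} [EMetricSpace M] [MeasurableSpace M] [BorelSpace M]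
  [ChartedSpace (EuclideanSpace ℝ (Fin d)) M] [RiemannianBundle (fun x : M => TangentSpace (𝓡 d) x)]

/-- The Dirichlet form `∫ ⟨∇f, ∇g⟩ w dx` with weight `w`: both the kinetic energy and the
potential of the Hamiltonian are values of this trilinear form. -/
def dirichletForm (w f g : C^∞⟮𝓡 d, M; ℝ⟯) : ℝ :=
  ∫ x, inner ℝ (grad f x) (grad g x) * w x ∂(vol d M)

lemma dirichletForm_comm (w f g : C^∞⟮𝓡 d, M; ℝ⟯) :
    dirichletForm w f g = dirichletForm w g f := by
  simp only [dirichletForm, real_inner_comm]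

lemma dirichletForm_zero_weight (f g : C^∞⟮𝓡 d, M; ℝ⟯) : dirichletForm 0 f g = 0 := by
  simp [dirichletForm]

lemma dirichletForm_zero_right (w f : C^∞⟮𝓡 d, M; ℝ⟯) : dirichletForm w f 0 = 0 := by
  simp [dirichletForm, grad_zero]

variable [IsManifold (𝓡 d) ∞ M] [CompactSpace M] [IsFiniteMeasureOnCompacts (vol d M)]
  [IsContinuousRiemannianBundle (EuclideanSpace ℝ (Fin d)) (fun x : M => TangentSpace (𝓡 d) x)]

lemma integrable_inner_grad_mul (w f g : C^∞⟮𝓡 d, M; ℝ⟯) :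
    Integrable (fun x => inner ℝ (grad f x) (grad g x) * w x) (vol d M) :=
  (continuous_inner_grad_mul w f g).integrable_of_hasCompactSupport (.of_compactSpace _)

theorem SmoothFamily.hasDerivAt_dirichletForm {w f g : ℝ → C^∞⟮𝓡 d, M; ℝ⟯} {O : Set ℝ} {t : ℝ}
    (hO : IsOpen O) (ht : t ∈ O) (hw : SmoothFamily O w) (hf : SmoothFamily O f)
    (hg : SmoothFamily O g) {w' f' g' : C^∞⟮𝓡 d, M; ℝ⟯} (hw' : HasPathDeriv w w' t)
    (hf' : HasPathDeriv f f' t) (hg' : HasPathDeriv g g' t) :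
    HasDerivAt (fun τ => dirichletForm (w τ) (f τ) (g τ))
      (dirichletForm w' (f t) (g t) + dirichletForm (w t) f' (g t) + dirichletForm (w t) (f t) g')
      t := by
  obtain ⟨a, ha, hwa⟩ := hw.hadamard hO ht
  obtain ⟨b, hb, hfb⟩ := hf.hadamard hO ht
  obtain ⟨c, hc, hgc⟩ := hg.hadamard hO ht
  obtain rfl : a t = w' := (ha.hasPathDeriv hwa).unique hw'
  obtain rfl : b t = f' := (hb.hasPathDeriv hfb).unique hf'
  obtain rfl : c t = g' := (hc.hasPathDeriv hgc).unique hg'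
  let k : ℝ → M → ℝ := fun τ x => inner ℝ (grad (f t) x) (grad (g t) x) * a τ x +
    inner ℝ (grad (b τ) x) (grad (g t) x) * w τ x + inner ℝ (grad (f τ) x) (grad (c τ) x) * w τ x
  have hcont {u v p : ℝ → C^∞⟮𝓡 d, M; ℝ⟯} (hu : SmoothFamily O u) (hv : SmoothFamily O v)
      (hp : SmoothFamily O p) :
      ContinuousOn (fun z : ℝ × M => inner ℝ (grad (u z.1) z.2) (grad (v z.1) z.2) * p z.1 z.2)
        (O ×ˢ Set.univ) :=
    (hu.continuousOn_inner_grad hO hv).mul (ContMDiffOn.continuousOn hp)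
  have hk : ContinuousOn (Function.uncurry k) (O ×ˢ Set.univ) :=
    ((hcont (smoothFamily_const _) (smoothFamily_const _) (ha.mono (Set.subset_univ _))).add
      (hcont (hb.mono (Set.subset_univ _)) (smoothFamily_const _) hw)).add
      (hcont hf (hc.mono (Set.subset_univ _)) hw)
  have hd := hasDerivAt_integral_of_eventually_eq_add_mul (μ := vol d M) hO ht
    (q := fun τ x => inner ℝ (grad (f τ) x) (grad (g τ) x) * w τ x)
    (continuous_inner_grad_mul _ _ _) hk ?_
  · refine hd.congr_deriv ?_
    have hint := integrable_inner_grad_mul (d := d) (M := M)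
    exact (integral_add ((hint _ _ _).add (hint _ _ _)) (hint _ _ _)).trans
      (congrArg (· + _) (integral_add (hint _ _ _) (hint _ _ _)))
  · filter_upwards [hwa, hfb, hgc] with τ hwτ hfτ hgτ x
    simp only [k, hwτ, hfτ, hgτ, grad_add, grad_smul, inner_add_left, inner_add_right,
      real_inner_smul_left, real_inner_smul_right, ContMDiffMap.coe_add, ContMDiffMap.coe_smul,
      Pi.add_apply, Pi.smul_apply, smul_eq_mul]
    ring

end DirichletForm

section SecondVariation

variable {d : ℕ} {M : Type*} [EMetricSpace M] [MeasurableSpace M] [BorelSpace M]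
  [ChartedSpace (EuclideanSpace ℝ (Fin d)) M] {U : Set C^∞⟮𝓡 d, M; ℝ⟯}
  {F : C^∞⟮𝓡 d, M; ℝ⟯ → ℝ} {f : C^∞⟮𝓡 d, M; ℝ⟯}

lemma IsSmoothPotential.hasFirstVariation_firstVariation (hF : IsSmoothPotential U F)
    (hf : f ∈ U) : HasFirstVariation F f (firstVariation F f) := by
  have h := hF.hasFirstVariation f hf
  rw [firstVariation, dif_pos h]
  exact h.choose_spec

lemma firstVariationInv_mem (hf : f ∈ firstVariation F '' U) : firstVariationInv U F f ∈ U :=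
  Function.invFunOn_mem hf

lemma firstVariation_firstVariationInv (hf : f ∈ firstVariation F '' U) :
    firstVariation F (firstVariationInv U F f) = f :=
  Function.invFunOn_eq hf

lemma IsInvertibleFirstVariation.firstVariationInv_firstVariation
    (hinv : IsInvertibleFirstVariation U F) (hf : f ∈ U) :
    firstVariationInv U F (firstVariation F f) = f :=
  hinv.injOn.leftInvOn_invFunOn hf

section Linear

variable {P : Type} [NormedAddCommGroup P] [NormedSpace ℝ P] [FiniteDimensional ℝ P]
  (l : P →ₗ[ℝ] C^∞⟮𝓡 d, M; ℝ⟯)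

lemma IsSmoothPotential.isOpen_setOf_add_mem (hF : IsSmoothPotential U F)
    (f : C^∞⟮𝓡 d, M; ℝ⟯) : IsOpen {v | f + l v ∈ U} := by
  simpa using hF.isOpen P Set.univ _ isOpen_univ
    ((smoothFamily_const f).add (smoothFamily_linearMap l))

lemma IsSmoothPotential.contDiffOn_add (hF : IsSmoothPotential U F) (f : C^∞⟮𝓡 d, M; ℝ⟯) :
    ContDiffOn ℝ ∞ (fun v => F (f + l v)) {v | f + l v ∈ U} :=
  hF.smooth P _ _ (hF.isOpen_setOf_add_mem l f) ((smoothFamily_const f).add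
    (smoothFamily_linearMap l)) fun _ hv => hv

lemma IsSmoothPotential.fderiv_add (hF : IsSmoothPotential U F) {v : P} (hv : f + l v ∈ U)
    (w : P) : fderiv ℝ (fun v => F (f + l v)) v w = pairing (firstVariation F (f + l v)) (l w) := by
  have hu := (hF.contDiffOn_add l f).contDiffAt ((hF.isOpen_setOf_add_mem l f).mem_nhds hv)
  refine ((hu.differentiableAt (by simp)).hasFDerivAt.hasLineDerivAt w).unique ?_
  simpa only [HasLineDerivAt, map_add, map_smul, add_assoc] using
    hF.hasFirstVariation_firstVariation hv (l w)

end Linear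

variable [IsManifold (𝓡 d) ∞ M]

lemma IsSmoothPotential.isLinearMap_secondVariation (hF : IsSmoothPotential U F) (hf : f ∈ U) :
    IsLinearMap ℝ (secondVariation F f) :=
  hF.smooth_firstVariation.isLinearMap_dirDeriv hF.isOpen hf

lemma IsSmoothPotential.hasPathDeriv_firstVariation_comp (hF : IsSmoothPotential U F)
    {p : ℝ → C^∞⟮𝓡 d, M; ℝ⟯} {O : Set ℝ} {t : ℝ} (hO : IsOpen O) (ht : t ∈ O)
    (hp : SmoothFamily O p) (hU : p t ∈ U) {p' : C^∞⟮𝓡 d, M; ℝ⟯} (hp' : HasPathDeriv p p' t) :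
    HasPathDeriv (fun τ => firstVariation F (p τ)) (secondVariation F (p t) p') t :=
  hF.smooth_firstVariation.hasPathDeriv_comp hF.isOpen hO hp ht hU hp'

theorem bijective_secondVariation (hF : IsSmoothPotential U F)
    (hinv : IsInvertibleFirstVariation U F) (hf : f ∈ U) :
    Function.Bijective (secondVariation F f) := by
  refine Function.bijective_iff_has_inverse.2
    ⟨dirDeriv (firstVariationInv U F) (firstVariation F f), fun φ => ?_, fun φ => ?_⟩
  · exact hF.smooth_firstVariation.dirDeriv_dirDeriv_of_leftInvOn hF.isOpen hinv.smooth_inv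
      hinv.isOpen_image (Set.mapsTo_image _ _) hinv.injOn.leftInvOn_invFunOn hf φ
  · have h := hinv.smooth_inv.dirDeriv_dirDeriv_of_leftInvOn hinv.isOpen_image
      hF.smooth_firstVariation hF.isOpen (fun _ => firstVariationInv_mem)
      (fun _ => firstVariation_firstVariationInv) ⟨f, hf, rfl⟩ φ
    rwa [hinv.firstVariationInv_firstVariation hf] at h

lemma secondVariation_secondVariationInv (hF : IsSmoothPotential U F)
    (hinv : IsInvertibleFirstVariation U F) (hf : f ∈ U) (α : C^∞⟮𝓡 d, M; ℝ⟯) :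
    secondVariation F f (secondVariationInv F f α) = α :=
  Function.rightInverse_invFun (bijective_secondVariation hF hinv hf).2 α

lemma secondVariationInv_secondVariation (hF : IsSmoothPotential U F)
    (hinv : IsInvertibleFirstVariation U F) (hf : f ∈ U) (α : C^∞⟮𝓡 d, M; ℝ⟯) :
    secondVariationInv F f (secondVariation F f α) = α :=
  Function.leftInverse_invFun (bijective_secondVariation hF hinv hf).1 α

variable [CompactSpace M] [IsFiniteMeasureOnCompacts (vol d M)]

lemma IsSmoothPotential.fderiv_fderiv_add (hF : IsSmoothPotential U F) (hf : f ∈ U) {P : Type}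
    [NormedAddCommGroup P] [NormedSpace ℝ P] [FiniteDimensional ℝ P]
    (l : P →ₗ[ℝ] C^∞⟮𝓡 d, M; ℝ⟯) (v w : P) :
    fderiv ℝ (fderiv ℝ fun v => F (f + l v)) 0 v w =
      pairing (secondVariation F f (l v)) (l w) := by
  set V : Set P := {v | f + l v ∈ U}
  have hV : IsOpen V := hF.isOpen_setOf_add_mem l f
  have h0 : (0 : P) ∈ V := by simpa [V] using hf
  have hd : DifferentiableAt ℝ (fderiv ℝ fun v => F (f + l v)) 0 :=
    (((hF.contDiffOn_add l f).fderiv_of_isOpen hV (m := ∞) le_rfl).contDiffAt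
      (hV.mem_nhds h0)).differentiableAt (by simp)
  have hline : HasDerivAt (fun ε : ℝ => fderiv ℝ (fun v => F (f + l v)) (0 + ε • v) w)
      (fderiv ℝ (fderiv ℝ fun v => F (f + l v)) 0 v w) 0 :=
    (hd.hasFDerivAt.hasLineDerivAt v).clm_apply (hasDerivAt_const 0 w) |>.congr_deriv (by simp)
  set I : Set ℝ := {ε | f + ε • l v ∈ U}
  have hI : IsOpen I := hF.isOpen.isOpen_setOf_add_smul_mem f (l v)
  have h0I : (0 : ℝ) ∈ I := by simpa [I] using hf
  have hpairing := (hF.smooth_firstVariation ℝ I _ hI ((smoothFamily_add_smul f (l v)).mono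
    (Set.subset_univ _)) fun _ hε => hε).hasDerivAt_pairing hI h0I
    (hF.smooth_firstVariation.hasPathDeriv_add_smul hF.isOpen hf (l v)) (l w)
  refine hline.unique (hpairing.congr_of_eventuallyEq ?_)
  filter_upwards [hI.mem_nhds h0I] with ε hε
  have hlv : f + l (0 + ε • v) = f + ε • l v := by rw [zero_add, map_smul]
  rw [hF.fderiv_add l (hlv ▸ hε), hlv]

theorem IsSmoothPotential.pairing_secondVariation_comm (hF : IsSmoothPotential U F) (hf : f ∈ U)
    (φ ψ : C^∞⟮𝓡 d, M; ℝ⟯) :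
    pairing (secondVariation F f φ) ψ = pairing φ (secondVariation F f ψ) := by
  let l : ℝ × ℝ →ₗ[ℝ] C^∞⟮𝓡 d, M; ℝ⟯ :=
    (LinearMap.toSpanSingleton ℝ _ φ).coprod (LinearMap.toSpanSingleton ℝ _ ψ)
  have hsymm : IsSymmSndFDerivAt ℝ (fun v => F (f + l v)) 0 :=
    ((hF.contDiffOn_add l f).contDiffAt ((hF.isOpen_setOf_add_mem l f).mem_nhds
      (by simpa using hf))).isSymmSndFDerivAt
        (by rw [minSmoothness_of_isRCLikeNormedField]; exact ENat.LEInfty.out)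
  have h := hsymm (1, 0) (0, 1)
  rw [hF.fderiv_fderiv_add hf, hF.fderiv_fderiv_add hf] at h
  simpa [l, pairing_comm φ] using h

lemma pairing_secondVariationInv_comm (hF : IsSmoothPotential U F)
    (hinv : IsInvertibleFirstVariation U F) (hf : f ∈ U) (α β : C^∞⟮𝓡 d, M; ℝ⟯) :
    pairing (secondVariationInv F f α) β = pairing α (secondVariationInv F f β) := by
  rw [← secondVariation_secondVariationInv hF hinv hf β, ← hF.pairing_secondVariation_comm hf,
    secondVariation_secondVariationInv hF hinv hf, secondVariationInv_secondVariation hF hinv hf]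

end SecondVariation

section Hamiltonian

variable {d : ℕ} {M : Type*} [EMetricSpace M] [MeasurableSpace M] [BorelSpace M]
  [ChartedSpace (EuclideanSpace ℝ (Fin d)) M] [RiemannianBundle (fun x : M => TangentSpace (𝓡 d) x)]
  {U : Set C^∞⟮𝓡 d, M; ℝ⟯} {F : C^∞⟮𝓡 d, M; ℝ⟯ → ℝ}

lemma hamiltonian_eq_dirichletForm (F : C^∞⟮𝓡 d, M; ℝ⟯ → ℝ) (ρ S : C^∞⟮𝓡 d, M; ℝ⟯) :
    hamiltonian F ρ S = 1 / 2 * dirichletForm ρ S S -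
      1 / 2 * dirichletForm ρ (firstVariation F ρ) (firstVariation F ρ) := by
  simp only [hamiltonian, dirichletForm, real_inner_self_eq_norm_sq]

variable [IsManifold (𝓡 d) ∞ M] [CompactSpace M] [IsFiniteMeasureOnCompacts (vol d M)]
  [IsContinuousRiemannianBundle (EuclideanSpace ℝ (Fin d)) (fun x : M => TangentSpace (𝓡 d) x)]

lemma IsSmoothPotential.hasDerivAt_hamiltonian_dirichletForm (hF : IsSmoothPotential U F)
    {ρ S : ℝ → C^∞⟮𝓡 d, M; ℝ⟯} {O : Set ℝ} {t : ℝ} (hO : IsOpen O) (ht : t ∈ O)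
    (hρ : SmoothFamily O ρ) (hS : SmoothFamily O S) (hU : ∀ τ ∈ O, ρ τ ∈ U)
    {ρ' S' : C^∞⟮𝓡 d, M; ℝ⟯} (hρ' : HasPathDeriv ρ ρ' t) (hS' : HasPathDeriv S S' t) :
    HasDerivAt (fun τ => hamiltonian F (ρ τ) (S τ))
      (1 / 2 * dirichletForm ρ' (S t) (S t) + dirichletForm (ρ t) (S t) S' -
        1 / 2 * dirichletForm ρ' (firstVariation F (ρ t)) (firstVariation F (ρ t)) -
        dirichletForm (ρ t) (firstVariation F (ρ t)) (secondVariation F (ρ t) ρ')) t := by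
  have hA : SmoothFamily O fun τ => firstVariation F (ρ τ) :=
    hF.smooth_firstVariation ℝ O ρ hO hρ hU
  have hA' := hF.hasPathDeriv_firstVariation_comp hO ht hρ (hU t ht) hρ'
  simp only [hamiltonian_eq_dirichletForm]
  refine (((SmoothFamily.hasDerivAt_dirichletForm hO ht hρ hS hS hρ' hS' hS').const_mul _).sub
    ((SmoothFamily.hasDerivAt_dirichletForm hO ht hρ hA hA hρ' hA' hA').const_mul _)).congr_deriv ?_
  rw [dirichletForm_comm _ S', dirichletForm_comm _ (secondVariation F (ρ t) ρ')]
  ring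

lemma IsSmoothPotential.pairing_eq_of_hasFirstVariation_momentum (hF : IsSmoothPotential U F)
    {ρ S g : C^∞⟮𝓡 d, M; ℝ⟯} (hρ : ρ ∈ U) (hg : HasFirstVariation (fun T => hamiltonian F ρ T) S g)
    (φ : C^∞⟮𝓡 d, M; ℝ⟯) : pairing g φ = dirichletForm ρ S φ := by
  have h := hF.hasDerivAt_hamiltonian_dirichletForm isOpen_univ trivial (smoothFamily_const ρ)
    (smoothFamily_add_smul S φ) (fun _ _ => hρ) (hasPathDeriv_const ρ 0) (hasPathDeriv_add_smul S φ)
  simpa [dirichletForm_zero_weight, dirichletForm_zero_right,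
    (hF.isLinearMap_secondVariation hρ).map_zero] using (hg φ).unique h

lemma IsSmoothPotential.pairing_eq_of_hasFirstVariation_density (hF : IsSmoothPotential U F)
    {ρ S g : C^∞⟮𝓡 d, M; ℝ⟯} (hρ : ρ ∈ U) (hg : HasFirstVariation (fun r => hamiltonian F r S) ρ g)
    (φ : C^∞⟮𝓡 d, M; ℝ⟯) :
    pairing g φ = 1 / 2 * dirichletForm φ S S -
      1 / 2 * dirichletForm φ (firstVariation F ρ) (firstVariation F ρ) -
      dirichletForm ρ (firstVariation F ρ) (secondVariation F ρ φ) := by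
  have h := hF.hasDerivAt_hamiltonian_dirichletForm (hF.isOpen.isOpen_setOf_add_smul_mem ρ φ)
    (by simpa using hρ) ((smoothFamily_add_smul ρ φ).mono (Set.subset_univ _))
    (smoothFamily_const S) (fun _ h => h) (hasPathDeriv_add_smul ρ φ) (hasPathDeriv_const S 0)
  simpa [dirichletForm_zero_right] using (hg φ).unique h

theorem IsSmoothPotential.hasDerivAt_hamiltonian (hF : IsSmoothPotential U F)
    {ρ S : ℝ → C^∞⟮𝓡 d, M; ℝ⟯} {O : Set ℝ} {t : ℝ} (hO : IsOpen O) (ht : t ∈ O)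
    (hρ : SmoothFamily O ρ) (hS : SmoothFamily O S) (hU : ∀ τ ∈ O, ρ τ ∈ U)
    {ρ' S' g₁ g₂ : C^∞⟮𝓡 d, M; ℝ⟯} (hρ' : HasPathDeriv ρ ρ' t) (hS' : HasPathDeriv S S' t)
    (hg₁ : HasFirstVariation (fun T => hamiltonian F (ρ t) T) (S t) g₁)
    (hg₂ : HasFirstVariation (fun r => hamiltonian F r (S t)) (ρ t) g₂) :
    HasDerivAt (fun τ => hamiltonian F (ρ τ) (S τ)) (pairing g₂ ρ' + pairing g₁ S') t := by
  refine (hF.hasDerivAt_hamiltonian_dirichletForm hO ht hρ hS hU hρ' hS').congr_deriv ?_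
  rw [hF.pairing_eq_of_hasFirstVariation_density (hU t ht) hg₂,
    hF.pairing_eq_of_hasFirstVariation_momentum (hU t ht) hg₁]
  ring

end Hamiltonian

section HopfColeTransformation

variable {d : ℕ} {M : Type*} [EMetricSpace M] [MeasurableSpace M] [BorelSpace M]
  [ChartedSpace (EuclideanSpace ℝ (Fin d)) M] {U : Set C^∞⟮𝓡 d, M; ℝ⟯}
  {F : C^∞⟮𝓡 d, M; ℝ⟯ → ℝ}

lemma hopfCole_fst_mem {q : C^∞⟮𝓡 d, M; ℝ⟯ × C^∞⟮𝓡 d, M; ℝ⟯} (hq : q ∈ hopfColeDomain U F) :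
    (hopfCole U F q).1 ∈ U :=
  firstVariationInv_mem hq.2.2

lemma firstVariation_hopfCole_fst {q : C^∞⟮𝓡 d, M; ℝ⟯ × C^∞⟮𝓡 d, M; ℝ⟯}
    (hq : q ∈ hopfColeDomain U F) :
    firstVariation F (hopfCole U F q).1 = firstVariation F q.1 + firstVariation F q.2 :=
  firstVariation_firstVariationInv hq.2.2

lemma swap_mem_hopfColeDomain {η ηs : C^∞⟮𝓡 d, M; ℝ⟯} (h : (η, ηs) ∈ hopfColeDomain U F) :
    (ηs, η) ∈ hopfColeDomain U F :=
  ⟨h.2.1, h.1, by simpa only [add_comm] using h.2.2⟩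

lemma hopfCole_fst_comm (η ηs : C^∞⟮𝓡 d, M; ℝ⟯) :
    (hopfCole U F (ηs, η)).1 = (hopfCole U F (η, ηs)).1 := by
  simp only [hopfCole, add_comm]

section Families

variable {P : Type} [NormedAddCommGroup P] [NormedSpace ℝ P] [FiniteDimensional ℝ P] {O : Set P}
  {p η ηs ρ S : P → C^∞⟮𝓡 d, M; ℝ⟯}

lemma isOpen_setOf_mem_hopfColeDomain (hF : IsSmoothPotential U F)
    (hinv : IsInvertibleFirstVariation U F) (hO : IsOpen O) (hη : SmoothFamily O η)
    (hηs : SmoothFamily O ηs) : IsOpen {v | v ∈ O ∧ (η v, ηs v) ∈ hopfColeDomain U F} := by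
  set V : Set P := {v | v ∈ O ∧ η v ∈ U} ∩ {v | v ∈ O ∧ ηs v ∈ U}
  have hV : IsOpen V := (hF.isOpen P O η hO hη).inter (hF.isOpen P O ηs hO hηs)
  have hVO : V ⊆ O := fun v hv => hv.1.1
  have hsum := (hF.smooth_firstVariation P V η hV (hη.mono hVO) fun v hv => hv.1.2).add
    (hF.smooth_firstVariation P V ηs hV (hηs.mono hVO) fun v hv => hv.2.2)
  convert hinv.isOpen_image P V _ hV hsum using 1
  ext v
  simp only [V, hopfColeDomain, Set.mem_ofPred_eq, Set.mem_inter_iff]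
  tauto

lemma smoothFamily_hopfCole_fst (hF : IsSmoothPotential U F)
    (hinv : IsInvertibleFirstVariation U F) (hO : IsOpen O) (hη : SmoothFamily O η)
    (hηs : SmoothFamily O ηs) (hdom : ∀ v ∈ O, (η v, ηs v) ∈ hopfColeDomain U F) :
    SmoothFamily O fun v => (hopfCole U F (η v, ηs v)).1 :=
  hinv.smooth_inv P O _ hO ((hF.smooth_firstVariation P O η hO hη fun v hv => (hdom v hv).1).add
    (hF.smooth_firstVariation P O ηs hO hηs fun v hv => (hdom v hv).2.1))
    fun v hv => (hdom v hv).2.2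

lemma smoothFamily_hopfCole_snd (hF : IsSmoothPotential U F) (hO : IsOpen O)
    (hη : SmoothFamily O η) (hηs : SmoothFamily O ηs)
    (hdom : ∀ v ∈ O, (η v, ηs v) ∈ hopfColeDomain U F) :
    SmoothFamily O fun v => (hopfCole U F (η v, ηs v)).2 :=
  (hF.smooth_firstVariation P O η hO hη fun v hv => (hdom v hv).1).sub
    (hF.smooth_firstVariation P O ηs hO hηs fun v hv => (hdom v hv).2.1)

lemma IsInvertibleFirstVariation.smoothFamily_of_firstVariation
    (hinv : IsInvertibleFirstVariation U F) (hO : IsOpen O) (hU : ∀ v ∈ O, p v ∈ U)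
    (hp : SmoothFamily O fun v => firstVariation F (p v)) : SmoothFamily O p :=
  (hinv.smooth_inv P O _ hO hp fun v hv => ⟨p v, hU v hv, rfl⟩).congr fun v hv =>
    (hinv.firstVariationInv_firstVariation (hU v hv)).symm

theorem smoothFamily_of_hopfCole_eq (hF : IsSmoothPotential U F)
    (hinv : IsInvertibleFirstVariation U F) (hO : IsOpen O) (hρ : SmoothFamily O ρ)
    (hS : SmoothFamily O S) (hdom : ∀ v ∈ O, (η v, ηs v) ∈ hopfColeDomain U F)
    (hs : ∀ v ∈ O, hopfCole U F (η v, ηs v) = (ρ v, S v)) :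
    SmoothFamily O η ∧ SmoothFamily O ηs := by
  have hρU (v : P) (hv : v ∈ O) : ρ v ∈ U := by simpa [hs v hv] using hopfCole_fst_mem (hdom v hv)
  have hA := hF.smooth_firstVariation P O ρ hO hρ hρU
  have hsum (v : P) (hv : v ∈ O) :
      firstVariation F (ρ v) = firstVariation F (η v) + firstVariation F (ηs v) := by
    simpa [hs v hv] using firstVariation_hopfCole_fst (hdom v hv)
  have hdiff (v : P) (hv : v ∈ O) : S v = firstVariation F (η v) - firstVariation F (ηs v) :=
    (congrArg Prod.snd (hs v hv)).symm
  refine ⟨hinv.smoothFamily_of_firstVariation hO (fun v hv => (hdom v hv).1) <|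
      (SmoothFamily.smul (c := fun _ => 1 / 2) contDiffOn_const (hA.add hS)).congr fun v hv => ?_,
    hinv.smoothFamily_of_firstVariation hO (fun v hv => (hdom v hv).2.1) <|
      (SmoothFamily.smul (c := fun _ => 1 / 2) contDiffOn_const (hA.sub hS)).congr fun v hv => ?_⟩
  all_goals
    rw [hsum v hv, hdiff v hv]
    module

end Families

variable [IsManifold (𝓡 d) ∞ M]

section Derivative

variable {O : Set ℝ} {t : ℝ} {η ηs : ℝ → C^∞⟮𝓡 d, M; ℝ⟯} {η' ηs' : C^∞⟮𝓡 d, M; ℝ⟯}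

lemma hasPathDeriv_hopfCole_snd (hF : IsSmoothPotential U F) (hO : IsOpen O) (ht : t ∈ O)
    (hη : SmoothFamily O η) (hηs : SmoothFamily O ηs) (hdom : (η t, ηs t) ∈ hopfColeDomain U F)
    (hη' : HasPathDeriv η η' t) (hηs' : HasPathDeriv ηs ηs' t) :
    HasPathDeriv (fun τ => (hopfCole U F (η τ, ηs τ)).2)
      (secondVariation F (η t) η' - secondVariation F (ηs t) ηs') t :=
  (hF.hasPathDeriv_firstVariation_comp hO ht hη hdom.1 hη').sub
    (hF.hasPathDeriv_firstVariation_comp hO ht hηs hdom.2.1 hηs')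

lemma hasPathDeriv_hopfCole_fst (hF : IsSmoothPotential U F)
    (hinv : IsInvertibleFirstVariation U F) (hO : IsOpen O) (ht : t ∈ O)
    (hη : SmoothFamily O η) (hηs : SmoothFamily O ηs)
    (hdom : ∀ τ ∈ O, (η τ, ηs τ) ∈ hopfColeDomain U F)
    (hη' : HasPathDeriv η η' t) (hηs' : HasPathDeriv ηs ηs' t) :
    HasPathDeriv (fun τ => (hopfCole U F (η τ, ηs τ)).1)
      (secondVariationInv F (hopfCole U F (η t, ηs t)).1
        (secondVariation F (η t) η' + secondVariation F (ηs t) ηs')) t := by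
  have hρ := smoothFamily_hopfCole_fst hF hinv hO hη hηs hdom
  obtain ⟨ρ', hρ'⟩ := hρ.exists_hasPathDeriv hO ht
  have hρU := hopfCole_fst_mem (hdom t ht)
  have hsum : secondVariation F (hopfCole U F (η t, ηs t)).1 ρ' =
      secondVariation F (η t) η' + secondVariation F (ηs t) ηs' := by
    refine (hF.hasPathDeriv_firstVariation_comp hO ht hρ hρU hρ').unique
      (((hF.hasPathDeriv_firstVariation_comp hO ht hη (hdom t ht).1 hη').add
        (hF.hasPathDeriv_firstVariation_comp hO ht hηs (hdom t ht).2.1 hηs')).congr ?_)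
    filter_upwards [hO.mem_nhds ht] with τ hτ using firstVariation_hopfCole_fst (hdom τ hτ)
  rwa [← hsum, secondVariationInv_secondVariation hF hinv hρU]

theorem secondVariation_eq_of_hopfCole_eq (hF : IsSmoothPotential U F)
    (hinv : IsInvertibleFirstVariation U F) (hO : IsOpen O) (ht : t ∈ O)
    (hη : SmoothFamily O η) (hηs : SmoothFamily O ηs)
    (hdom : ∀ τ ∈ O, (η τ, ηs τ) ∈ hopfColeDomain U F)
    {ρ S : ℝ → C^∞⟮𝓡 d, M; ℝ⟯} {ρ' S' : C^∞⟮𝓡 d, M; ℝ⟯}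
    (hs : ∀ τ ∈ O, hopfCole U F (η τ, ηs τ) = (ρ τ, S τ))
    (hη' : HasPathDeriv η η' t) (hηs' : HasPathDeriv ηs ηs' t)
    (hρ' : HasPathDeriv ρ ρ' t) (hS' : HasPathDeriv S S' t) :
    secondVariation F (η t) η' = (1 / 2 : ℝ) • (secondVariation F (ρ t) ρ' + S') ∧
      secondVariation F (ηs t) ηs' = (1 / 2 : ℝ) • (secondVariation F (ρ t) ρ' - S') := by
  have hs_near := hO.eventually_mem ht |>.mono hs
  have hρU := hopfCole_fst_mem (hdom t ht)
  have hfst := hρ'.unique <|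
    (hasPathDeriv_hopfCole_fst hF hinv hO ht hη hηs hdom hη' hηs').congr <|
      hs_near.mono fun τ hτ => (congrArg Prod.fst hτ).symm
  have hsnd := hS'.unique <|
    (hasPathDeriv_hopfCole_snd hF hO ht hη hηs (hdom t ht) hη' hηs').congr <|
      hs_near.mono fun τ hτ => (congrArg Prod.snd hτ).symm
  rw [hs t ht] at hfst hρU
  rw [hfst, hsnd, secondVariation_secondVariationInv hF hinv hρU]
  constructor <;> module

end Derivative

end HopfColeTransformation

section Sigma

variable {d : ℕ} {M : Type*} [EMetricSpace M] [MeasurableSpace M] [BorelSpace M]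
  [ChartedSpace (EuclideanSpace ℝ (Fin d)) M] [IsManifold (𝓡 d) ∞ M]
  {U : Set C^∞⟮𝓡 d, M; ℝ⟯} {F : C^∞⟮𝓡 d, M; ℝ⟯ → ℝ} {η ηs : C^∞⟮𝓡 d, M; ℝ⟯}

lemma sigma_secondVariation (hF : IsSmoothPotential U F) (hinv : IsInvertibleFirstVariation U F)
    (hηs : ηs ∈ U) (α : C^∞⟮𝓡 d, M; ℝ⟯) :
    sigma U F η ηs (secondVariation F ηs α) = (-(1 / 2) : ℝ) •
      secondVariationInv F η (secondVariation F (hopfCole U F (η, ηs)).1 α) := by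
  rw [sigma, secondVariationInv_secondVariation hF hinv hηs]

lemma sigma_secondVariation_eq (hF : IsSmoothPotential U F)
    (hinv : IsInvertibleFirstVariation U F) (h : (η, ηs) ∈ hopfColeDomain U F)
    {α β : C^∞⟮𝓡 d, M; ℝ⟯} (hαβ : secondVariation F η β =
      (-(1 / 2) : ℝ) • secondVariation F (hopfCole U F (η, ηs)).1 α) :
    sigma U F η ηs (secondVariation F ηs α) = β := by
  have hlin : secondVariation F η ((-2 : ℝ) • β) =
      secondVariation F (hopfCole U F (η, ηs)).1 α := by
    rw [(hF.isLinearMap_secondVariation h.1).map_smul, hαβ]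
    module
  rw [sigma, secondVariationInv_secondVariation hF hinv h.2.1, ← hlin,
    secondVariationInv_secondVariation hF hinv h.1]
  module

theorem hasPathDeriv_sigma_of_hopfCole_eq (hF : IsSmoothPotential U F)
    (hinv : IsInvertibleFirstVariation U F) {J : Set ℝ} {t : ℝ} (hJ : IsOpen J) (ht : t ∈ J)
    {η ηs ρ S : ℝ → C^∞⟮𝓡 d, M; ℝ⟯} (hη : SmoothFamily J η) (hηs : SmoothFamily J ηs)
    (hdom : ∀ τ ∈ J, (η τ, ηs τ) ∈ hopfColeDomain U F)
    (hs : ∀ τ ∈ J, hopfCole U F (η τ, ηs τ) = (ρ τ, S τ)) {g₁ g₂ : C^∞⟮𝓡 d, M; ℝ⟯}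
    (hρ' : HasPathDeriv ρ g₁ t) (hS' : HasPathDeriv S (-g₂) t) :
    HasPathDeriv η (sigma U F (η t) (ηs t)
      (secondVariation F (ηs t) (secondVariationInv F (ρ t) g₂ - g₁))) t ∧
    HasPathDeriv ηs (-sigma U F (ηs t) (η t)
      (secondVariation F (η t) (secondVariationInv F (ρ t) g₂ + g₁))) t := by
  obtain ⟨η', hη'⟩ := hη.exists_hasPathDeriv hJ ht
  obtain ⟨ηs', hηs'⟩ := hηs.exists_hasPathDeriv hJ ht
  obtain ⟨hvar, hvars⟩ :=
    secondVariation_eq_of_hopfCole_eq hF hinv hJ ht hη hηs hdom hs hη' hηs' hρ' hS'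
  have hfst : (hopfCole U F (η t, ηs t)).1 = ρ t := congrArg Prod.fst (hs t ht)
  have hρ : ρ t ∈ U := hfst ▸ hopfCole_fst_mem (hdom t ht)
  have hlin := hF.isLinearMap_secondVariation hρ
  have hη_eq : sigma U F (η t) (ηs t)
      (secondVariation F (ηs t) (secondVariationInv F (ρ t) g₂ - g₁)) = η' := by
    refine sigma_secondVariation_eq hF hinv (hdom t ht) ?_
    rw [hvar, hfst, hlin.map_sub, secondVariation_secondVariationInv hF hinv hρ]
    module
  have hηs_eq : sigma U F (ηs t) (η t)
      (secondVariation F (η t) (secondVariationInv F (ρ t) g₂ + g₁)) = -ηs' := by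
    refine sigma_secondVariation_eq hF hinv (swap_mem_hopfColeDomain (hdom t ht)) ?_
    rw [(hF.isLinearMap_secondVariation (hdom t ht).2.1).map_neg, hvars, hopfCole_fst_comm, hfst,
      hlin.map_add, secondVariation_secondVariationInv hF hinv hρ]
    module
  rw [hη_eq, hηs_eq, neg_neg]
  exact ⟨hη', hηs'⟩

variable [CompactSpace M] [IsFiniteMeasureOnCompacts (vol d M)]

theorem pairing_sigma (hF : IsSmoothPotential U F) (hinv : IsInvertibleFirstVariation U F)
    (h : (η, ηs) ∈ hopfColeDomain U F) (a b : C^∞⟮𝓡 d, M; ℝ⟯) :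
    pairing (sigma U F η ηs (secondVariation F ηs a)) (secondVariation F η b) =
      -(1 / 2) * pairing (secondVariation F (hopfCole U F (η, ηs)).1 a) b := by
  rw [sigma_secondVariation hF hinv h.2.1, pairing_smul_left,
    pairing_secondVariationInv_comm hF hinv h.1, secondVariationInv_secondVariation hF hinv h.1]

theorem pairing_sigma_swap (hF : IsSmoothPotential U F) (hinv : IsInvertibleFirstVariation U F)
    (h : (η, ηs) ∈ hopfColeDomain U F) (α β : C^∞⟮𝓡 d, M; ℝ⟯) :
    pairing (sigma U F ηs η α) β = pairing α (sigma U F η ηs β) := by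
  obtain ⟨a, rfl⟩ := (bijective_secondVariation hF hinv h.1).2 α
  obtain ⟨b, rfl⟩ := (bijective_secondVariation hF hinv h.2.1).2 β
  rw [pairing_sigma hF hinv (swap_mem_hopfColeDomain h), pairing_comm (secondVariation F η a),
    pairing_sigma hF hinv h, hopfCole_fst_comm,
    hF.pairing_secondVariation_comm (hopfCole_fst_mem h), pairing_comm a]

end Sigma

section HopfColeHamiltonian

variable {d : ℕ} {M : Type*} [EMetricSpace M] [CompactSpace M] [MeasurableSpace M] [BorelSpace M]
  [ChartedSpace (EuclideanSpace ℝ (Fin d)) M] [IsManifold (𝓡 d) ∞ M]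
  [IsFiniteMeasureOnCompacts (vol d M)] [RiemannianBundle (fun x : M => TangentSpace (𝓡 d) x)]
  [IsContinuousRiemannianBundle (EuclideanSpace ℝ (Fin d)) (fun x : M => TangentSpace (𝓡 d) x)]
  {U : Set C^∞⟮𝓡 d, M; ℝ⟯} {F : C^∞⟮𝓡 d, M; ℝ⟯ → ℝ}

theorem hasDerivAt_hopfColeHamiltonian (hF : IsSmoothPotential U F)
    (hinv : IsInvertibleFirstVariation U F) {O : Set ℝ} {t : ℝ} (hO : IsOpen O) (ht : t ∈ O)
    {η ηs : ℝ → C^∞⟮𝓡 d, M; ℝ⟯} (hη : SmoothFamily O η) (hηs : SmoothFamily O ηs)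
    (hdom : ∀ τ ∈ O, (η τ, ηs τ) ∈ hopfColeDomain U F) {η' ηs' ρ S g₁ g₂ : C^∞⟮𝓡 d, M; ℝ⟯}
    (hη' : HasPathDeriv η η' t) (hηs' : HasPathDeriv ηs ηs' t)
    (hs : hopfCole U F (η t, ηs t) = (ρ, S))
    (hg₁ : HasFirstVariation (fun T => hamiltonian F ρ T) S g₁)
    (hg₂ : HasFirstVariation (fun r => hamiltonian F r S) ρ g₂) :
    HasDerivAt (fun τ => hopfColeHamiltonian U F (η τ) (ηs τ))
      (pairing (secondVariation F (η t) (secondVariationInv F ρ g₂ + g₁)) η' +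
        pairing (secondVariation F (ηs t) (secondVariationInv F ρ g₂ - g₁)) ηs') t := by
  obtain ⟨rfl, rfl⟩ := Prod.mk.inj hs
  have hchain := hF.hasDerivAt_hamiltonian hO ht (smoothFamily_hopfCole_fst hF hinv hO hη hηs hdom)
    (smoothFamily_hopfCole_snd hF hO hη hηs hdom) (fun τ hτ => hopfCole_fst_mem (hdom τ hτ))
    (hasPathDeriv_hopfCole_fst hF hinv hO ht hη hηs hdom hη' hηs')
    (hasPathDeriv_hopfCole_snd hF hO ht hη hηs (hdom t ht) hη' hηs') hg₁ hg₂
  refine hchain.congr_deriv ?_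
  rw [← pairing_secondVariationInv_comm hF hinv (hopfCole_fst_mem (hdom t ht)),
    hF.pairing_secondVariation_comm (hdom t ht).1, hF.pairing_secondVariation_comm (hdom t ht).2.1,
    pairing_add_left, pairing_sub_left, pairing_add_right, pairing_sub_right]
  simp only [hopfCole]
  ring

section FirstVariation

variable {η ηs ρ S g₁ g₂ : C^∞⟮𝓡 d, M; ℝ⟯}

theorem hasFirstVariation_hopfColeHamiltonian_left (hF : IsSmoothPotential U F)
    (hinv : IsInvertibleFirstVariation U F) (hdom : (η, ηs) ∈ hopfColeDomain U F)
    (hs : hopfCole U F (η, ηs) = (ρ, S))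
    (hg₁ : HasFirstVariation (fun T => hamiltonian F ρ T) S g₁)
    (hg₂ : HasFirstVariation (fun r => hamiltonian F r S) ρ g₂) :
    HasFirstVariation (fun ξ => hopfColeHamiltonian U F ξ ηs) η
      (secondVariation F η (secondVariationInv F ρ g₂ + g₁)) := fun φ => by
  have hO := isOpen_setOf_mem_hopfColeDomain hF hinv isOpen_univ (smoothFamily_add_smul η φ)
    (smoothFamily_const ηs)
  simpa [pairing_zero_right] using hasDerivAt_hopfColeHamiltonian hF hinv (t := 0) hO
    (by simpa using hdom) ((smoothFamily_add_smul η φ).mono (Set.subset_univ _))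
    (smoothFamily_const ηs) (fun _ h => h.2) (hasPathDeriv_add_smul η φ)
    (hasPathDeriv_const ηs 0) (by simpa using hs) hg₁ hg₂

theorem hasFirstVariation_hopfColeHamiltonian_right (hF : IsSmoothPotential U F)
    (hinv : IsInvertibleFirstVariation U F) (hdom : (η, ηs) ∈ hopfColeDomain U F)
    (hs : hopfCole U F (η, ηs) = (ρ, S))
    (hg₁ : HasFirstVariation (fun T => hamiltonian F ρ T) S g₁)
    (hg₂ : HasFirstVariation (fun r => hamiltonian F r S) ρ g₂) :
    HasFirstVariation (fun ξ => hopfColeHamiltonian U F η ξ) ηs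
      (secondVariation F ηs (secondVariationInv F ρ g₂ - g₁)) := fun φ => by
  have hO := isOpen_setOf_mem_hopfColeDomain hF hinv isOpen_univ (smoothFamily_const η)
    (smoothFamily_add_smul ηs φ)
  simpa [pairing_zero_right] using hasDerivAt_hopfColeHamiltonian hF hinv (t := 0) hO
    (by simpa using hdom) (smoothFamily_const η)
    ((smoothFamily_add_smul ηs φ).mono (Set.subset_univ _)) (fun _ h => h.2)
    (hasPathDeriv_const η 0) (hasPathDeriv_add_smul ηs φ) (by simpa using hs) hg₁ hg₂

end FirstVariation

end HopfColeHamiltonian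

end HopfCole

end

open HopfCole in
theorem mainTheorem2_general {d : ℕ} {M : Type*} [EMetricSpace M] [CompactSpace M]
    [MeasurableSpace M] [BorelSpace M]
    [ChartedSpace (EuclideanSpace ℝ (Fin d)) M] [IsManifold (𝓡 d) ∞ M]
    [IsFiniteMeasureOnCompacts (vol d M)]
    [RiemannianBundle (fun x : M => TangentSpace (𝓡 d) x)]
    [IsContinuousRiemannianBundle (EuclideanSpace ℝ (Fin d)) (fun x : M => TangentSpace (𝓡 d) x)]
    (U : Set C^∞⟮𝓡 d, M; ℝ⟯) (F : C^∞⟮𝓡 d, M; ℝ⟯ → ℝ)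
    (hF : IsSmoothPotential U F) (hinv : IsInvertibleFirstVariation U F) :
    (∀ (J : Set ℝ) (ρ S η ηs : ℝ → C^∞⟮𝓡 d, M; ℝ⟯), IsOpen J → SmoothFamily J ρ →
      SmoothFamily J S →
      (∀ t ∈ J, ∃ g, HasFirstVariation (fun T => hamiltonian F (ρ t) T) (S t) g ∧
        HasPathDeriv ρ g t) →
      (∀ t ∈ J, ∃ g, HasFirstVariation (fun r => hamiltonian F r (S t)) (ρ t) g ∧
        HasPathDeriv S (-g) t) →
      (∀ t ∈ J, (η t, ηs t) ∈ hopfColeDomain U F ∧ hopfCole U F (η t, ηs t) = (ρ t, S t)) →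
      SmoothFamily J η ∧ SmoothFamily J ηs ∧
      ∀ t ∈ J, ∃ κ κs : C^∞⟮𝓡 d, M; ℝ⟯,
        HasFirstVariation (fun ξ => hopfColeHamiltonian U F ξ (ηs t)) (η t) κ ∧
        HasFirstVariation (fun ξ => hopfColeHamiltonian U F (η t) ξ) (ηs t) κs ∧
        HasPathDeriv η (sigma U F (η t) (ηs t) κs) t ∧
        HasPathDeriv ηs (-sigma U F (ηs t) (η t) κ) t) ∧
    (∀ f ∈ U, Function.Bijective (secondVariation F f)) ∧
    ∀ η ηs : C^∞⟮𝓡 d, M; ℝ⟯, (η, ηs) ∈ hopfColeDomain U F →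
      (∀ α β a b : C^∞⟮𝓡 d, M; ℝ⟯, secondVariation F ηs a = α → secondVariation F η b = β →
        pairing (sigma U F η ηs α) β =
          -(1 / 2) * pairing (secondVariation F (hopfCole U F (η, ηs)).1 a) b) ∧
      (∀ α β : C^∞⟮𝓡 d, M; ℝ⟯,
        pairing (sigma U F ηs η α) β = pairing α (sigma U F η ηs β)) := by
  refine ⟨fun J ρ S η ηs hJ hρ hS hdensity hmomentum hs => ?_,
    fun f => bijective_secondVariation hF hinv, fun η ηs hdom =>
      ⟨by rintro _ _ a b rfl rfl; exact pairing_sigma hF hinv hdom a b,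
        pairing_sigma_swap hF hinv hdom⟩⟩
  have hdom (t : ℝ) (ht : t ∈ J) := (hs t ht).1
  have hs (t : ℝ) (ht : t ∈ J) := (hs t ht).2
  obtain ⟨hη, hηs⟩ := smoothFamily_of_hopfCole_eq hF hinv hJ hρ hS hdom hs
  refine ⟨hη, hηs, fun t ht => ?_⟩
  obtain ⟨g₁, hg₁, hρ'⟩ := hdensity t ht
  obtain ⟨g₂, hg₂, hS'⟩ := hmomentum t ht
  exact ⟨_, _, hasFirstVariation_hopfColeHamiltonian_left hF hinv (hdom t ht) (hs t ht) hg₁ hg₂,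
    hasFirstVariation_hopfColeHamiltonian_right hF hinv (hdom t ht) (hs t ht) hg₁ hg₂,
    hasPathDeriv_sigma_of_hopfCole_eq hF hinv hJ ht hη hηs hdom hs hρ' hS'⟩

open HopfCole in
theorem mainTheorem2 {d : ℕ} {M : Type*} [EMetricSpace M] [CompactSpace M]
    [MeasurableSpace M] [BorelSpace M]
    [ChartedSpace (EuclideanSpace ℝ (Fin d)) M] [IsManifold (𝓡 d) ∞ M]
    [RiemannianBundle (fun x : M => TangentSpace (𝓡 d) x)]
    [IsContMDiffRiemannianBundle (𝓡 d) ∞ (EuclideanSpace ℝ (Fin d))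
      (fun x : M => TangentSpace (𝓡 d) x)]
    [IsRiemannianManifold (𝓡 d) M]
    (U : Set C^∞⟮𝓡 d, M; ℝ⟯) (F : C^∞⟮𝓡 d, M; ℝ⟯ → ℝ)
    (hF : IsSmoothPotential U F) (hinv : IsInvertibleFirstVariation U F) :
    -- the equations satisfied by the Hopf--Cole variables along the flow
    (∀ (J : Set ℝ) (ρ S η ηs : ℝ → C^∞⟮𝓡 d, M; ℝ⟯), IsOpen J → IsHamiltonianFlow J U F ρ S →
      (∀ t ∈ J, (η t, ηs t) ∈ hopfColeDomain U F ∧ hopfCole U F (η t, ηs t) = (ρ t, S t)) →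
      SmoothFamily J η ∧ SmoothFamily J ηs ∧
      ∀ t ∈ J, ∃ κ κs : C^∞⟮𝓡 d, M; ℝ⟯,
        HasFirstVariation (fun ξ => hopfColeHamiltonian U F ξ (ηs t)) (η t) κ ∧
        HasFirstVariation (fun ξ => hopfColeHamiltonian U F (η t) ξ) (ηs t) κs ∧
        HasPathDeriv η (sigma U F (η t) (ηs t) κs) t ∧
        HasPathDeriv ηs (-sigma U F (ηs t) (η t) κ) t) ∧
    -- the operator `σ`: the inverses exist, the formula on test functions, and the adjoint
    (∀ f ∈ U, Function.Bijective (secondVariation F f)) ∧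
    ∀ η ηs : C^∞⟮𝓡 d, M; ℝ⟯, (η, ηs) ∈ hopfColeDomain U F →
      (∀ α β a b : C^∞⟮𝓡 d, M; ℝ⟯, secondVariation F ηs a = α → secondVariation F η b = β →
        pairing (sigma U F η ηs α) β =
          -(1 / 2) * pairing (secondVariation F (hopfCole U F (η, ηs)).1 a) b) ∧
      (∀ α β : C^∞⟮𝓡 d, M; ℝ⟯,
        pairing (sigma U F ηs η α) β = pairing α (sigma U F η ηs β)) := by
  have : IsManifold (𝓡 d) 1 M := .of_le (n := ∞) (by simp)
  have : IsContinuousRiemannianBundle (EuclideanSpace ℝ (Fin d))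
      (fun x : M => TangentSpace (𝓡 d) x) := isContinuousRiemannianBundle_of_isContMDiff (𝓡 d) ∞
  have : IsLocallyFiniteMeasure (vol d M) := isLocallyFiniteMeasure_vol
  refine ⟨fun J ρ S η ηs hJ h => ?_, (mainTheorem2_general U F hF hinv).2⟩
  exact (mainTheorem2_general U F hF hinv).1 J ρ S η ηs hJ h.smooth_density h.smooth_momentum
    h.density_eq h.momentum_eq
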